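/- Let $V$ be a two-sided quaternionic Banach space, i.e. a two-sided vector space over the quaternions $\mathbb H$, complete for a norm with $\|av\|=\|va\|=|a|\,\|v\|$ for $a\in\mathbb H$, $v\in V$. Let $(\mathcal U(t))_{t\in\mathbb R}$ be a strongly continuous group of bounded right linear operators on $V$ with $\|\mathcal U(t)\|\le K e^{\omega|t|}$ for all $t\in\mathbb R$, where $K,\omega$ are constants and $\omega\ge 0$. Let $T$ be its infinitesimal generator, $Tv=\lim_{h\to0^+}\frac1h(\mathcal U(h)v-v)$, defined for those $v$ for which this limit exists. Let $\mathbf S(T)$ be the set of $\mathbb H$-valued measures $\mu$ on the Borel sets of $\mathbb R$, with total variation $|\mu|$, such that $\int_{\mathbb R}e^{(\omega+\varepsilon)|t|}\,d|\mu|(t)<\infty$ for some $\varepsilon>0$. Let $\mathbf V(T)$ be the set of the functions $f(s)=\int_{\mathbb R}d\mu(t)\,e^{-st}$, $|\mathrm{Re}\,s|<\omega+\varepsilon$, with $\mu\in\mathbf S(T)$ and such an $\varepsilon$. For such an $f$ put $f(T)v=\int_{\mathbb R}d\mu(t)\,\mathcal U(-t)v$, $v\in V$. A function $f\in\mathbf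 V(T)$, or a polynomial $f(s)=\sum_k a_ks^k$ with $a_k\in\mathbb H$, is called intrinsic if $f(\overline s)=\overline{f(s)}$ for all $s$ in its domain. For a polynomial $P(s)=\sum_{k=0}^m a_ks^k$ of degree $m$ let $P[T]=\sum_{k=0}^m a_kT^k$ with domain $\mathcal D(T^m)$. **Theorem 5.4.** Let $f\in\mathbf V(T)$ be intrinsic and let $(P_n)_{n\in\mathbb N}$ be an inverting sequence for $f$, that is, a sequence of intrinsic polynomials such that 1. $P_nf\in\mathbf V(T)$ for all $n$; 2. there are $\varepsilon>0$ and $M>0$ such that $|P_n(s)f(s)|\le M$ for all $n$ and $\lim_{n\to\infty}P_n(s)f(s)=1$, for every $s\in\mathbb H$ with $|\mathrm{Re}\,s|\le\omega+\varepsilon$; 3. there is $M>0$ such that $\|(P_nf)(T)\|\le M$ for all $n$. Then $f(T)u\in\mathcal D(P_n[T])$ for all $n$ and all $u\in V$, and $$\lim_{n\to\infty}P_n[T]f(T)u=u\qquad\text{for all }u\in V.$$ -/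

import Mathlib

open MeasureTheory Filter Topology
open scoped Quaternion ENNReal

namespace QuatCalc

noncomputable section

/-! ### Quaternionic measures and their Laplace-Stieltjes transforms -/

/-- The pairing `(x, q) ↦ q * x` on `ℍ`, so that `∫ᵛ t, g t ∂[mulPairing; μ] = ∫ dμ(t) g(t)`
with the measure to the left of the integrand. -/
def mulPairing : ℍ →L[ℝ] ℍ →L[ℝ] ℍ :=
  (ContinuousLinearMap.mul ℝ ℍ).flip

/-- The bilateral right Laplace-Stieltjes transform `s ↦ ∫ dμ(t) e^{-st}` of a quaternionic
measure `μ` on the Borel sets of `ℝ`. -/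
def laplace (μ : VectorMeasure ℝ ℍ) (s : ℍ) : ℍ :=
  ∫ᵛ t, NormedSpace.exp (-(t • s)) ∂[mulPairing; μ]

/-- `∫ e^{(ω+ε)|t|} d|μ|(t) < ∞`, where `|μ|` is the total variation of `μ`. -/
def ExpIntegrable (ω ε : ℝ) (μ : VectorMeasure ℝ ℍ) : Prop :=
  ∫⁻ t, ENNReal.ofReal (Real.exp ((ω + ε) * |t|)) ∂μ.variation < ∞

/-- The class `𝐒(T)` of quaternionic measures, for a group of growth bound `ω`. -/
def classS (ω : ℝ) : Set (VectorMeasure ℝ ℍ) :=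
  {μ | ∃ ε > 0, ExpIntegrable ω ε μ}

/-- `f` is the Laplace-Stieltjes transform of `μ` on a strip `|Re s| < ω + ε`, `ε > 0`, on which
`μ` has the exponential moment required in `𝐒(T)`. In particular `μ ∈ 𝐒(T)`. Functions on strips
are represented by total functions `ℍ → ℍ`, whose values off the strip play no role. -/
def IsLaplaceOf (ω : ℝ) (f : ℍ → ℍ) (μ : VectorMeasure ℝ ℍ) : Prop :=
  ∃ ε > 0, ExpIntegrable ω ε μ ∧ ∀ s : ℍ, |s.re| < ω + ε → f s = laplace μ s

/-- The class `𝐕(T)` of the transforms of the measures in `𝐒(T)`. -/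
def classV (ω : ℝ) : Set (ℍ → ℍ) :=
  {f | ∃ μ ∈ classS ω, IsLaplaceOf ω f μ}

/-- `f` commutes with conjugation on the set `A`. (Elements of `𝐕(T)` and polynomials with
coefficients on the left are automatically right slice regular, so for them this is what
"intrinsic" means.) -/
def IsIntrinsicOn (A : Set ℍ) (f : ℍ → ℍ) : Prop :=
  ∀ s ∈ A, f (star s) = star (f s)

/-- Intrinsic polynomials `s ↦ ∑ aₖ sᵏ`. -/
def IsIntrinsicPoly (P : Polynomial ℍ) : Prop :=
  IsIntrinsicOn Set.univ (fun s => P.eval s)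

/-! ### Strongly continuous groups of right linear operators -/

section Operators

variable {V : Type*} [NormedAddCommGroup V] [NormedSpace ℝ V] [Module ℍ V] [Module ℍᵐᵒᵖ V]

/-- A strongly continuous group of bounded right linear operators on `V`; right linear means
linear over `ℍᵐᵒᵖ`. -/
structure StronglyContGroup (V : Type*) [NormedAddCommGroup V] [Module ℍᵐᵒᵖ V] where
  /-- the operators of the group -/
  toFun : ℝ → V →L[ℍᵐᵒᵖ] V
  map_zero : toFun 0 = ContinuousLinearMap.id ℍᵐᵒᵖ V
  map_add : ∀ s t, toFun (s + t) = (toFun s).comp (toFun t)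
  continuous_orbit : ∀ v, Continuous fun t => toFun t v

instance {V : Type*} [NormedAddCommGroup V] [Module ℍᵐᵒᵖ V] :
    CoeFun (StronglyContGroup V) (fun _ => ℝ → V →L[ℍᵐᵒᵖ] V) :=
  ⟨StronglyContGroup.toFun⟩

/-- The difference quotients `h⁻¹ (U(h) v - v)`. -/
def diffQuot (U : StronglyContGroup V) (v : V) (h : ℝ) : V :=
  h⁻¹ • (U h v - v)

/-- The infinitesimal generator `T` of the group:
`T v = lim_{h → 0+} h⁻¹ (U(h) v - v)`, on the subspace of all `v` for which this limit exists. -/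
def generator [NormSMulClass ℍᵐᵒᵖ V] [SMulCommClass ℝ ℍᵐᵒᵖ V] (U : StronglyContGroup V) :
    V →ₗ.[ℍᵐᵒᵖ] V where
  domain :=
    { carrier := {v | ∃ w, Tendsto (diffQuot U v) (𝓝[>] 0) (𝓝 w)}
      zero_mem' := ⟨0, by
        have h : diffQuot U (0 : V) = fun _ => 0 := by funext h; simp [diffQuot]
        rw [h]; exact tendsto_const_nhds⟩
      add_mem' := by
        rintro a b ⟨x, hx⟩ ⟨y, hy⟩
        refine ⟨x + y, (hx.add hy).congr fun h => ?_⟩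
        simp only [diffQuot, map_add, ← smul_add]
        congr 1; abel
      smul_mem' := by
        rintro c a ⟨x, hx⟩
        refine ⟨c • x, (hx.const_smul c).congr fun h => ?_⟩
        simp only [diffQuot, map_smul, ← smul_sub]
        rw [smul_comm] }
  toFun :=
    { toFun := fun v => v.2.choose
      map_add' := by
        rintro ⟨a, ha⟩ ⟨b, hb⟩
        refine tendsto_nhds_unique (Exists.choose_spec (p := fun w =>
          Tendsto (diffQuot U (a + b)) (𝓝[>] 0) (𝓝 w)) _) ?_
        refine (ha.choose_spec.add hb.choose_spec).congr fun h => ?_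
        simp only [diffQuot, map_add, ← smul_add]
        congr 1; abel
      map_smul' := by
        rintro c ⟨a, ha⟩
        refine tendsto_nhds_unique (Exists.choose_spec (p := fun w =>
          Tendsto (diffQuot U (c • a)) (𝓝[>] 0) (𝓝 w)) _) ?_
        refine (ha.choose_spec.const_smul c).congr fun h => ?_
        simp only [diffQuot, map_smul, ← smul_sub]
        rw [smul_comm] }

/-! ### Powers and polynomials of an unbounded operator -/

/-- The composition `A B` of unbounded operators, with domain `{v ∈ 𝒟(B) : B v ∈ 𝒟(A)}`. -/
def pcomp (A B : V →ₗ.[ℍᵐᵒᵖ] V) : V →ₗ.[ℍᵐᵒᵖ] V :=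
  A.comp (B.domRestrict ((A.domain.comap B.toFun).map B.domain.subtype)) (by
    rintro ⟨x, ⟨⟨y, hy, rfl⟩, hx⟩⟩
    exact hy)

/-- `Tᵏ`, with `T⁰ = 𝓘` on all of `V` and `𝒟(Tᵏ⁺¹) = {v ∈ 𝒟(Tᵏ) : Tᵏ v ∈ 𝒟(T)}`. -/
def ppow (T : V →ₗ.[ℍᵐᵒᵖ] V) : ℕ → (V →ₗ.[ℍᵐᵒᵖ] V)
  | 0 => LinearMap.toPMap LinearMap.id ⊤
  | k + 1 => pcomp T (ppow T k)

/-- `P[T] = ∑_{k ≤ m} aₖ Tᵏ` for a polynomial `P = ∑_{k ≤ m} aₖ sᵏ` of degree `m`. The domain of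
the sum is the intersection of the domains `𝒟(Tᵏ)`, `k ≤ m`, that is, `𝒟(Tᵐ)`. -/
def polyOp [SMulCommClass ℍᵐᵒᵖ ℍ V] (P : Polynomial ℍ) (T : V →ₗ.[ℍᵐᵒᵖ] V) : V →ₗ.[ℍᵐᵒᵖ] V :=
  ∑ k ∈ Finset.range (P.natDegree + 1), P.coeff k • ppow T k

/-! ### Functions of the generator -/

variable [NormSMulClass ℍ V] [IsScalarTower ℝ ℍ V]

/-- The pairing `(v, q) ↦ q • v` (scalar multiplication on the left), so that
`∫ᵛ t, F t ∂[smulPairing V; μ] = ∫ dμ(t) F(t)` with the measure to the left of the integrand. -/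
def smulPairing (V : Type*) [NormedAddCommGroup V] [NormedSpace ℝ V] [Module ℍ V]
    [NormSMulClass ℍ V] [IsScalarTower ℝ ℍ V] : V →L[ℝ] ℍ →L[ℝ] V :=
  LinearMap.mkContinuous₂
    (LinearMap.mk₂ ℝ (fun (v : V) (q : ℍ) => q • v)
      (fun v w q => smul_add q v w)
      (fun c v q => by
        rw [← algebraMap_smul ℍ c v, ← algebraMap_smul ℍ c (q • v), smul_smul, smul_smul,
          Algebra.commutes])
      (fun v p q => add_smul p q v)
      (fun c v q => smul_assoc c q v))
    1 (fun v q => by simp [norm_smul, mul_comm])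

open Classical in
/-- The operator `f(T) v = ∫ dμ(t) U(-t) v` for `f ∈ 𝐕(T)`, where `μ ∈ 𝐒(T)` is the (unique)
measure with transform `f`. Off `𝐕(T)` the value `0` is a placeholder. -/
def funCalc (U : StronglyContGroup V) (ω : ℝ) (f : ℍ → ℍ) (v : V) : V :=
  if h : f ∈ classV ω then ∫ᵛ t, U (-t) v ∂[smulPairing V; h.choose] else 0

/-- `(Pₙ)` is an inverting sequence of intrinsic polynomials for `f`. -/
structure IsInvertingSequence (U : StronglyContGroup V) (ω : ℝ) (f : ℍ → ℍ)
    (P : ℕ → Polynomial ℍ) : Prop where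
  intrinsic : ∀ n, IsIntrinsicPoly (P n)
  mem : ∀ n, (fun s => (P n).eval s * f s) ∈ classV ω
  strip : ∃ ε > 0, ∃ M > 0, ∀ s : ℍ, |s.re| ≤ ω + ε →
    (∀ n, ‖(P n).eval s * f s‖ ≤ M) ∧ Tendsto (fun n => (P n).eval s * f s) atTop (𝓝 1)
  bounded : ∃ M > 0, ∀ n v, ‖funCalc U ω (fun s => (P n).eval s * f s) v‖ ≤ M * ‖v‖

end Operators

end

end QuatCalc

/-! The proof rests on two facts: `P[T] f(T) = (P f)(T)` when `P` and `f` are intrinsic and `P f ∈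
𝐕(T)`, and strong convergence of `(Pₙ f)(T)` to the identity. Both are first proved on the smoothed
vectors `S_c u = ∫ g_c(t) U(-t) u dt`, with `g_c` the heat kernel, and then extended to all `u` by
letting `c → 0`.

The heat kernel is chosen because `g_c⁽ᵏ⁾` is the inverse Laplace transform of `zᵏ e^{cz²}` along
every vertical line (`ofReal_gaussKer`). It therefore decays faster than any exponential, `S_c u`
lies in the domain of every power of `T`, and Fubini turns `f(T) Tᵏ S_c u` into `∫ h(r) U(-r) u dr`,
where `h = g_c⁽ᵏ⁾ * μ` is the inverse transform of `zᵏ e^{cz²} f(z)` (`heatConv_eq_line`,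
`densOp_smoothing`). All of this happens in one complex slice of `ℍ`. Intrinsicness enters by making
the measure of `f` and the coefficients of `P` real (`IsExpDensity.ae_eq_re`,
`IsIntrinsicPoly.exists_real`), so that the noncommutativity of `ℍ` does no harm and `f(T)` commutes
with the group.

Comparing transforms gives `(P f)(T) S_c u = P[T] f(T) S_c u`. As `c → 0` both `f(T) S_c u` and
`P[T] f(T) S_c u` converge. Dividing `P` by `X - λ` and applying the resolvent lowers the degree, so
every `Tᵏ f(T) S_c u` with `k ≤ deg P` converges too (`exists_tendsto_of_polynomial`), and
closedness of `T` gives the first fact (`polyOp_funCalc_eq`).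

For the second, `(Pₙ f)(T) S_c u = ∫ hₙ(r) U(-r) u dr` with `hₙ` the inverse transform of `Pₙ f
e^{cz²}`. The bound on the strip, used on two lines `Re z = ±A` with `A > ω`, dominates `hₙ` by a
multiple of `e^{-A|r|}`, and `hₙ → g_c` pointwise (`tendsto_funCalc_smoothing`). The uniform bound
on `(Pₙ f)(T)` passes from smoothed vectors to all vectors. -/

namespace QuatCalc

/-! ### Radon-Nikodym densities of vector measures -/

section Density

variable {X E F G : Type*} [MeasurableSpace X]
  [NormedAddCommGroup E] [NormedSpace ℝ E] [NormedAddCommGroup F] [NormedSpace ℝ F]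
  [NormedAddCommGroup G] [NormedSpace ℝ G]

/-- A finite-dimensional vector measure of finite variation has a density with respect to its
variation. -/
theorem exists_density [FiniteDimensional ℝ F]
    (μ : VectorMeasure X F) [IsFiniteMeasure μ.variation] :
    ∃ θ : X → F, StronglyMeasurable θ ∧ Integrable θ μ.variation ∧ μ.variation.withDensityᵥ θ = μ := by
  have : CompleteSpace F := FiniteDimensional.complete ℝ F
  set ν := μ.variation with hν
  -- In coordinates the measure becomes finitely many signed measures, each absolutely continuous
  -- with respect to the variation, so the scalar Radon-Nikodym theorem applies.
  let e : F ≃L[ℝ] (Fin (Module.finrank ℝ F) → ℝ) := (Module.finBasis ℝ F).equivFunL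
  let φ : Fin (Module.finrank ℝ F) → F →L[ℝ] ℝ := fun i =>
    (ContinuousLinearMap.proj (R := ℝ) (φ := fun _ => ℝ) i).comp (e : F →L[ℝ] _)
  let m : Fin (Module.finrank ℝ F) → SignedMeasure X := fun i =>
    μ.mapRange (φ i).toLinearMap.toAddMonoidHom (φ i).continuous
  have hm : ∀ i s, m i s = φ i (μ s) := fun i s => rfl
  have hac : ∀ i, VectorMeasure.AbsolutelyContinuous (m i) ν.toENNRealVectorMeasure := by
    intro i
    refine VectorMeasure.AbsolutelyContinuous.mk fun s hs h0 => ?_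
    rw [Measure.toENNRealVectorMeasure_apply_measurable hs] at h0
    have : ‖μ s‖ₑ ≤ 0 := h0 ▸ VectorMeasure.enorm_measure_le_variation μ s
    rw [hm, enorm_eq_zero.1 (le_antisymm this bot_le), map_zero]
  let r : Fin (Module.finrank ℝ F) → X → ℝ := fun i => (m i).rnDeriv ν
  have hr : ∀ i, Measurable (r i) := fun i => SignedMeasure.measurable_rnDeriv _ _
  have hri : ∀ i, Integrable (r i) ν := fun i => SignedMeasure.integrable_rnDeriv _ _
  have hrm : ∀ i, ν.withDensityᵥ (r i) = m i := fun i =>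
    SignedMeasure.withDensityᵥ_rnDeriv_eq _ _ (hac i)
  let θ : X → F := fun t => e.symm fun i => r i t
  have hθi : Integrable θ ν :=
    (e.symm : (Fin (Module.finrank ℝ F) → ℝ) →L[ℝ] F).integrable_comp (Integrable.of_eval hri)
  refine ⟨θ, e.symm.continuous.comp_stronglyMeasurable
    (measurable_pi_lambda _ hr).stronglyMeasurable, hθi, ?_⟩
  ext s hs
  rw [withDensityᵥ_apply hθi hs]
  apply e.injective
  funext i
  change φ i _ = φ i _
  rw [← hm, ← hrm, withDensityᵥ_apply (hri i) hs,
    ← ContinuousLinearMap.integral_comp_comm _ hθi.integrableOn]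
  congr 1 with t
  simp [φ, θ]

/-- Both sides are continuous in `g` for the `L¹` norm and additive, and they agree on indicators.
This makes Fubini and dominated convergence for Bochner integrals available. -/
theorem integral_vectorMeasure_eq [CompleteSpace F] [CompleteSpace G] (B : E →L[ℝ] F →L[ℝ] G)
    (μ : VectorMeasure X F) [IsFiniteMeasure μ.variation] {θ : X → F} (hθ : Integrable θ μ.variation)
    (hμ : μ.variation.withDensityᵥ θ = μ) (hθ1 : ∀ᵐ t ∂μ.variation, ‖θ t‖ ≤ 1)
    {g : X → E} (hg : Integrable g μ.variation) :
    VectorMeasure.integral μ g B = ∫ t, B (g t) (θ t) ∂μ.variation := by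
  have hint : ∀ {g : X → E}, Integrable g μ.variation →
      Integrable (fun t => B (g t) (θ t)) μ.variation := by
    intro g hg
    refine (hg.norm.const_mul ‖B‖).mono'
      (B.aestronglyMeasurable_comp₂ hg.aestronglyMeasurable hθ.aestronglyMeasurable) ?_
    filter_upwards [hθ1] with t ht
    calc ‖B (g t) (θ t)‖ ≤ ‖B‖ * ‖g t‖ * ‖θ t‖ := B.le_opNorm₂ _ _
      _ ≤ ‖B‖ * ‖g t‖ * 1 := by gcongr
      _ = _ := mul_one _
  refine Integrable.induction (P := fun g => VectorMeasure.integral μ g B =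
    ∫ t, B (g t) (θ t) ∂μ.variation) ?_ ?_ ?_ ?_ hg
  · intro c s hs _
    rw [VectorMeasure.integral_indicator_const _ hs]
    nth_rw 1 [← hμ]
    rw [withDensityᵥ_apply hθ hs, ← ContinuousLinearMap.integral_comp_comm _ hθ.integrableOn,
      ← integral_indicator hs]
    congr 1 with t
    by_cases ht : t ∈ s <;> simp [ht]
  · intro f g _ hf hg h1 h2
    rw [VectorMeasure.integral_add hf hg, h1, h2, ← integral_add (hint hf) (hint hg)]
    simp
  · refine isClosed_eq VectorMeasure.continuous_integral ?_
    refine (LipschitzWith.of_dist_le_mul (K := ‖B‖₊) fun f g => ?_).continuous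
    rw [dist_eq_norm, ← integral_sub (hint (L1.integrable_coeFn f)) (hint (L1.integrable_coeFn g)),
      dist_eq_norm, L1.norm_eq_integral_norm, coe_nnnorm, ← integral_const_mul]
    refine norm_integral_le_of_norm_le ((L1.integrable_coeFn (f - g)).norm.const_mul _) ?_
    filter_upwards [hθ1, Lp.coeFn_sub f g] with t ht h
    rw [h, Pi.sub_apply, ← sub_apply, ← map_sub]
    calc ‖B (f t - g t) (θ t)‖ ≤ ‖B‖ * ‖f t - g t‖ * ‖θ t‖ := B.le_opNorm₂ _ _
      _ ≤ ‖B‖ * ‖f t - g t‖ * 1 := by gcongr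
      _ = _ := mul_one _
  · intro f g hfg hf h
    rw [← VectorMeasure.integral_congr_ae hfg, h]
    exact integral_congr_ae (by filter_upwards [hfg] with t ht; rw [ht])

/-- The variation of `θ dν` is `‖θ‖ dν`; for `ν` the variation itself this forces norm one. -/
theorem norm_density_eq_one [CompleteSpace F] (μ : VectorMeasure X F) [IsFiniteMeasure μ.variation]
    {θ : X → F} (hθ : Integrable θ μ.variation) (hμ : μ.variation.withDensityᵥ θ = μ) :
    ∀ᵐ t ∂μ.variation, ‖θ t‖ = 1 := by
  have h := Measure.variation_withDensityᵥ hθ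
  rw [hμ] at h
  have h1 : μ.variation.withDensity (fun t => ‖θ t‖ₑ) = μ.variation.withDensity (fun _ => 1) := by
    rw [← h]; exact withDensity_one.symm
  rw [withDensity_eq_iff hθ.aestronglyMeasurable.enorm aemeasurable_const hθ.2.ne] at h1
  filter_upwards [h1] with t ht
  rw [← toReal_enorm, ht]; simp

end Density

/-! ### Concrete form of the functional calculus -/

/-- `dμ = θ dν` with `ν` finite, `‖θ‖ ≤ 1` and exponential moment of order `κ`. -/
structure IsExpDensity (κ : ℝ) (ν : Measure ℝ) (θ : ℝ → ℍ) : Prop where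
  finite : IsFiniteMeasure ν
  measurable : StronglyMeasurable θ
  norm_le : ∀ t, ‖θ t‖ ≤ 1
  moment : Integrable (fun t => Real.exp (κ * |t|)) ν

variable {V : Type*} [NormedAddCommGroup V] [NormedSpace ℝ V] [Module ℍ V] [Module ℍᵐᵒᵖ V]

/-- The operator `v ↦ ∫ θ(t) U(-t) v dν(t)`. -/
noncomputable def densOp (U : StronglyContGroup V) (ν : Measure ℝ) (θ : ℝ → ℍ) (v : V) : V :=
  ∫ t, θ t • U (-t) v ∂ν

/-- The function `s ↦ ∫ θ(t) e^{-ts} dν(t)`. -/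
noncomputable def densFun (ν : Measure ℝ) (θ : ℝ → ℍ) (s : ℍ) : ℍ :=
  ∫ t, θ t * NormedSpace.exp (-(t • s)) ∂ν

theorem norm_exp_neg_smul (t : ℝ) (s : ℍ) :
    ‖NormedSpace.exp (-(t • s))‖ = Real.exp (-(t * s.re)) := by
  rw [Quaternion.norm_exp, ← Real.exp_eq_exp_ℝ, Real.norm_eq_abs, Real.abs_exp]
  simp

theorem continuous_exp_neg_smul (s : ℍ) :
    Continuous fun t : ℝ => NormedSpace.exp (-(t • s)) := by
  let _ : NormedAlgebra ℚ ℍ := NormedAlgebra.restrictScalars ℚ ℝ ℍ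
  exact NormedSpace.exp_continuous.comp (by fun_prop)

theorem exp_neg_mul_le {κ a : ℝ} (h : |a| ≤ κ) (t : ℝ) :
    Real.exp (-(t * a)) ≤ Real.exp (κ * |t|) := by
  apply Real.exp_le_exp.2
  calc -(t * a) ≤ |t * a| := neg_le_abs _
    _ = |a| * |t| := by rw [abs_mul, mul_comm]
    _ ≤ κ * |t| := by gcongr

/-- From here on the calculus is seen only through a density. It comes from the very measure chosen
in `funCalc`, so uniqueness of the measure is never needed. -/
theorem exists_isExpDensity [CompleteSpace V] [NormSMulClass ℍ V] [IsScalarTower ℝ ℍ V]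
    (U : StronglyContGroup V) {ω K : ℝ} (hω : 0 ≤ ω)
    (hU : ∀ t v, ‖U t v‖ ≤ K * Real.exp (ω * |t|) * ‖v‖) {f : ℍ → ℍ} (hf : f ∈ classV ω) :
    ∃ ε > 0, ∃ ν θ, IsExpDensity (ω + ε) ν θ ∧ (∀ s : ℍ, |s.re| < ω + ε → f s = densFun ν θ s) ∧
      ∀ v, funCalc U ω f v = densOp U ν θ v := by
  obtain ⟨-, ε, hε, hint, hfs⟩ := hf.choose_spec
  have hfc : ∀ v, funCalc U ω f v = VectorMeasure.integral hf.choose (fun t => U (-t) v)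
      (smulPairing V) := fun v => by rw [funCalc, dif_pos hf]
  generalize hf.choose = μ at hint hfs hfc
  have hmom : Integrable (fun t => Real.exp ((ω + ε) * |t|)) μ.variation := by
    refine ⟨by fun_prop, ?_⟩
    rw [hasFiniteIntegral_iff_ofReal (Eventually.of_forall fun t => (Real.exp_pos _).le)]
    exact hint
  have hfin : IsFiniteMeasure μ.variation := by
    have h1 : Integrable (fun _ => (1 : ℝ)) μ.variation :=
      hmom.mono' (by fun_prop) (Eventually.of_forall fun t => by
        rw [norm_one]; exact Real.one_le_exp (by positivity))
    simpa [integrable_const_iff] using h1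
  obtain ⟨θ, hθm, hθi, hθ⟩ := exists_density μ
  have hθ1 := norm_density_eq_one μ hθi hθ
  -- The norm bound holds only almost everywhere; the density is cut off to have it everywhere.
  let θ' : ℝ → ℍ := {t | ‖θ t‖ ≤ 1}.indicator θ
  have hθ' : θ' =ᵐ[μ.variation] θ := by
    filter_upwards [hθ1] with t ht
    exact Set.indicator_of_mem (s := {t | ‖θ t‖ ≤ 1}) ht.le θ
  refine ⟨ε, hε, μ.variation, θ', ⟨hfin, ?_, ?_, hmom⟩, ?_, ?_⟩
  · exact hθm.indicator (measurableSet_le hθm.norm.measurable measurable_const)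
  · intro t
    by_cases ht : t ∈ {t | ‖θ t‖ ≤ 1}
    · simp only [θ', Set.indicator_of_mem ht]
      exact ht
    · simp [θ', Set.indicator_of_notMem ht]
  · intro s hs
    rw [hfs s hs, laplace, integral_vectorMeasure_eq mulPairing μ hθi hθ (hθ1.mono fun _ h => h.le)]
    · refine integral_congr_ae ?_
      filter_upwards [hθ'] with t ht
      rw [ht]; rfl
    · refine hmom.mono' (continuous_exp_neg_smul s).aestronglyMeasurable
        (Eventually.of_forall fun t => ?_)
      rw [norm_exp_neg_smul]
      exact exp_neg_mul_le hs.le t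
  · intro v
    rw [hfc v, integral_vectorMeasure_eq (smulPairing V) μ hθi hθ (hθ1.mono fun _ h => h.le)]
    · refine integral_congr_ae ?_
      filter_upwards [hθ'] with t ht
      rw [ht]; rfl
    · refine ((hmom.const_mul (|K|)).mul_const ‖v‖).mono'
        ((U.continuous_orbit v).comp continuous_neg).aestronglyMeasurable
        (Eventually.of_forall fun t => (hU (-t) v).trans ?_)
      rw [abs_neg]
      gcongr
      · exact le_abs_self K
      · linarith

/-! ### Derivatives of Gaussian kernels -/

/-- The point `a + iy` of the complex plane. -/
noncomputable def linePt (a y : ℝ) : ℂ := a + y * Complex.I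

@[simp] theorem linePt_re (a y : ℝ) : (linePt a y).re = a := by simp [linePt]

@[simp] theorem linePt_im (a y : ℝ) : (linePt a y).im = y := by simp [linePt]

@[fun_prop] theorem continuous_linePt (a : ℝ) : Continuous (linePt a) := by
  unfold linePt; fun_prop

/-- `‖z‖ᵏ |e^{cz²}|` on the line `z = a + iy`. -/
noncomputable def lineWeight (c : ℝ) (k : ℕ) (a y : ℝ) : ℝ :=
  ‖linePt a y‖ ^ k * Real.exp (c * (a ^ 2 - y ^ 2))

/-- `e^{cz² + rz}` on the line `z = a + iy`. -/
noncomputable def lineExp (c a r y : ℝ) : ℂ :=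
  Complex.exp (c * linePt a y ^ 2 + linePt a y * r)

theorem norm_lineExp (c a r y : ℝ) :
    ‖lineExp c a r y‖ = Real.exp (c * (a ^ 2 - y ^ 2)) * Real.exp (a * r) := by
  rw [lineExp, Complex.norm_exp, ← Real.exp_add]
  congr 1
  simp [pow_two, linePt]

theorem continuous_lineExp (c a r : ℝ) : Continuous (lineExp c a r) := by
  unfold lineExp; fun_prop

theorem lineWeight_nonneg (c : ℝ) (k : ℕ) (a y : ℝ) : 0 ≤ lineWeight c k a y := by
  unfold lineWeight; positivity

theorem integrable_exp_quadratic {c : ℝ} (hc : 0 < c) (b d : ℝ) :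
    Integrable fun y : ℝ => Real.exp (-c * y ^ 2 + b * y + d) := by
  refine (integrable_cexp_quadratic' (b := ((-c : ℝ) : ℂ)) (by simpa using hc) b d).norm.congr
    (Eventually.of_forall fun y => ?_)
  simp only [Complex.norm_exp]
  norm_cast

theorem integrable_lineWeight {c : ℝ} (hc : 0 < c) (k : ℕ) (a : ℝ) :
    Integrable (lineWeight c k a) := by
  have h := ((integrable_exp_quadratic hc 1 (c * a ^ 2 + |a|)).add
    (integrable_exp_quadratic hc (-1) (c * a ^ 2 + |a|))).const_mul (k.factorial : ℝ)
  refine h.mono' (by unfold lineWeight; fun_prop) (Eventually.of_forall fun y => ?_)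
  rw [Real.norm_of_nonneg (lineWeight_nonneg c k a y), lineWeight]
  have h1 : ‖linePt a y‖ ≤ |a| + |y| := by
    simpa using Complex.norm_le_abs_re_add_abs_im (linePt a y)
  have h2 : ‖linePt a y‖ ^ k ≤ k.factorial * Real.exp (|a| + |y|) := by
    have := Real.pow_div_factorial_le_exp (|a| + |y|) (by positivity) k
    rw [div_le_iff₀ (by positivity)] at this
    calc ‖linePt a y‖ ^ k ≤ (|a| + |y|) ^ k := by gcongr
      _ ≤ _ := by linarith
  have h3 : Real.exp |y| ≤ Real.exp y + Real.exp (-y) := by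
    rcases abs_cases y with ⟨h, -⟩ | ⟨h, -⟩ <;> rw [h] <;> linarith [Real.exp_pos y, Real.exp_pos (-y)]
  calc ‖linePt a y‖ ^ k * Real.exp (c * (a ^ 2 - y ^ 2))
      ≤ (k.factorial * Real.exp (|a| + |y|)) * Real.exp (c * (a ^ 2 - y ^ 2)) := by gcongr
    _ = k.factorial * (Real.exp |y| * Real.exp (-c * y ^ 2 + (c * a ^ 2 + |a|))) := by
      rw [mul_assoc, ← Real.exp_add, ← Real.exp_add]; ring_nf
    _ ≤ k.factorial * ((Real.exp y + Real.exp (-y)) *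
          Real.exp (-c * y ^ 2 + (c * a ^ 2 + |a|))) := by gcongr
    _ = _ := by
      simp only [Pi.add_apply]
      rw [add_mul, ← Real.exp_add, ← Real.exp_add]; ring_nf

theorem norm_pow_mul_lineExp (c : ℝ) (k : ℕ) (a r y : ℝ) :
    ‖linePt a y ^ k * lineExp c a r y‖ = lineWeight c k a y * Real.exp (a * r) := by
  rw [norm_mul, norm_pow, norm_lineExp, lineWeight, mul_assoc]

theorem integrable_pow_mul_lineExp {c : ℝ} (hc : 0 < c) (k : ℕ) (a r : ℝ) :
    Integrable fun y => linePt a y ^ k * lineExp c a r y := by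
  refine ((integrable_lineWeight hc k a).mul_const (Real.exp (a * r))).mono'
    (((continuous_linePt a).pow k).mul (continuous_lineExp c a r)).aestronglyMeasurable
    (Eventually.of_forall fun y => (norm_pow_mul_lineExp c k a r y).le)

/-- `∫ zᵏ e^{cz² + rz} dy` over the line `z = a + iy`. -/
noncomputable def lineInt (c : ℝ) (k : ℕ) (a r : ℝ) : ℂ :=
  ∫ y, linePt a y ^ k * lineExp c a r y

theorem hasDerivAt_lineInt {c : ℝ} (hc : 0 < c) (k : ℕ) (a r : ℝ) :
    HasDerivAt (lineInt c k a) (lineInt c (k + 1) a r) r := by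
  have hmeas : ∀ k r, AEStronglyMeasurable (fun y => linePt a y ^ k * lineExp c a r y) volume :=
    fun k r => (((continuous_linePt a).pow k).mul (continuous_lineExp c a r)).aestronglyMeasurable
  refine (hasDerivAt_integral_of_dominated_loc_of_deriv_le (s := Metric.ball r 1)
    (F := fun r y => linePt a y ^ k * lineExp c a r y)
    (F' := fun r y => linePt a y ^ (k + 1) * lineExp c a r y)
    (bound := fun y => lineWeight c (k + 1) a y * Real.exp (|a| * (|r| + 1)))
    (Metric.ball_mem_nhds r one_pos) (Eventually.of_forall (hmeas k))
    (integrable_pow_mul_lineExp hc k a r) (hmeas (k + 1) r) (Eventually.of_forall fun y x hx => ?_)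
    ((integrable_lineWeight hc (k + 1) a).mul_const _) (Eventually.of_forall fun y x _ => ?_)).2
  · rw [norm_pow_mul_lineExp]
    have hx : |x| ≤ |r| + 1 := by
      have h1 : |x - r| < 1 := hx
      calc |x| = |r + (x - r)| := by ring_nf
        _ ≤ |r| + |x - r| := abs_add_le _ _
        _ ≤ |r| + 1 := by linarith
    have := lineWeight_nonneg c (k + 1) a y
    refine mul_le_mul_of_nonneg_left (Real.exp_le_exp.2 ?_) this
    calc a * x ≤ |a * x| := le_abs_self _
      _ = |a| * |x| := abs_mul _ _
      _ ≤ _ := by gcongr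
  · have h1 : HasDerivAt (fun x : ℝ => (c * linePt a y ^ 2 + linePt a y * x : ℂ))
        (linePt a y) x := by
      simpa using ((Complex.ofRealCLM.hasDerivAt (x := x)).const_mul (linePt a y)).const_add
        (c * linePt a y ^ 2 : ℂ)
    refine (h1.cexp.const_mul (linePt a y ^ k)).congr_deriv ?_
    rw [lineExp]; ring

/-- The `k`-th derivative of the heat kernel `(4πc)^{-1/2} e^{-r²/4c}`. -/
noncomputable def gaussKer (c : ℝ) (k : ℕ) : ℝ → ℝ :=
  iteratedDeriv k fun r => (2 * √(Real.pi * c))⁻¹ * Real.exp (-r ^ 2 / (4 * c))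

theorem gaussKer_zero (c r : ℝ) :
    gaussKer c 0 r = (2 * √(Real.pi * c))⁻¹ * Real.exp (-r ^ 2 / (4 * c)) := by
  simp [gaussKer]

/-- For `k = 0` this is the Gaussian integral, whose value does not depend on `a`; each derivative
in `r` then brings down a factor `z`. Freedom in `a` replaces contour shifting. -/
theorem ofReal_gaussKer {c : ℝ} (hc : 0 < c) (k : ℕ) (a r : ℝ) :
    (gaussKer c k r : ℂ) = (2 * Real.pi : ℂ)⁻¹ * lineInt c k a r := by
  induction k generalizing r with
  | zero =>
    have hb : ((-c : ℝ) : ℂ).re < 0 := by simpa using hc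
    have hcc : (c : ℂ) ≠ 0 := by exact_mod_cast hc.ne'
    have h := integral_cexp_quadratic hb ((2 * c * a + r) * Complex.I) (c * a ^ 2 + a * r)
    have h2 : lineInt c 0 a r = ((√(Real.pi / c) : ℝ) : ℂ) * Complex.exp (-r ^ 2 / (4 * c)) := by
      rw [lineInt]
      convert h using 1
      · congr 1 with y
        rw [pow_zero, one_mul, lineExp, linePt]
        congr 1
        push_cast
        linear_combination (c * y ^ 2 : ℂ) * Complex.I_sq
      · congr 1
        · rw [Real.sqrt_eq_rpow, Complex.ofReal_cpow (by positivity)]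
          push_cast
          rw [neg_neg]
        · congr 1
          push_cast
          field_simp
          linear_combination (-(2 * c * a + r) ^ 2 : ℂ) * Complex.I_sq
    have hk : (2 * √(Real.pi * c))⁻¹ = (2 * Real.pi)⁻¹ * √(Real.pi / c) := by
      have hpi := Real.pi_pos
      rw [Real.sqrt_mul hpi.le, Real.sqrt_div hpi.le]
      have h3 := Real.mul_self_sqrt hpi.le
      have h4 : 0 < √Real.pi := Real.sqrt_pos.2 hpi
      have h5 : 0 < √c := Real.sqrt_pos.2 hc
      field_simp
      linarith
    rw [h2, gaussKer_zero, hk]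
    push_cast
    ring
  | succ k ih =>
    have h1 : HasDerivAt (fun r => (gaussKer c k r : ℂ))
        ((2 * Real.pi : ℂ)⁻¹ * lineInt c (k + 1) a r) r := by
      simp_rw [ih]
      exact (hasDerivAt_lineInt hc k a r).const_mul _
    -- The derivative of a real-valued function is real: its imaginary part is the derivative of the
    -- constant 0.
    have h2 := Complex.reCLM.hasFDerivAt.comp_hasDerivAt r h1
    have h3 := Complex.imCLM.hasFDerivAt.comp_hasDerivAt r h1
    have h4 : gaussKer c (k + 1) r = ((2 * Real.pi : ℂ)⁻¹ * lineInt c (k + 1) a r).re := by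
      rw [gaussKer, iteratedDeriv_succ]
      exact h2.deriv
    have h5 : ((2 * Real.pi : ℂ)⁻¹ * lineInt c (k + 1) a r).im = 0 :=
      h3.unique (hasDerivAt_const r (0 : ℝ))
    apply Complex.ext
    · rw [← h4, Complex.ofReal_re]
    · rw [h5, Complex.ofReal_im]

theorem hasDerivAt_gaussKer {c : ℝ} (hc : 0 < c) (k : ℕ) (r : ℝ) :
    HasDerivAt (gaussKer c k) (gaussKer c (k + 1) r) r := by
  have h1 : HasDerivAt (fun r => (gaussKer c k r : ℂ)) (gaussKer c (k + 1) r : ℂ) r := by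
    simp_rw [ofReal_gaussKer hc k 0, ofReal_gaussKer hc (k + 1) 0]
    exact (hasDerivAt_lineInt hc k 0 r).const_mul _
  exact Complex.reCLM.hasFDerivAt.comp_hasDerivAt r h1

theorem continuous_gaussKer {c : ℝ} (hc : 0 < c) (k : ℕ) : Continuous (gaussKer c k) :=
  continuous_iff_continuousAt.2 fun r => (hasDerivAt_gaussKer hc k r).continuousAt

/-- A function on the line bounded by `C₁ e^{Ar}` and `C₂ e^{-Ar}` decays exponentially. -/
theorem le_max_mul_exp_neg_abs {A C₁ C₂ x r : ℝ} (h₁ : x ≤ C₁ * Real.exp (A * r))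
    (h₂ : x ≤ C₂ * Real.exp (-A * r)) : x ≤ max C₁ C₂ * Real.exp (-(A * |r|)) := by
  rcases abs_cases r with ⟨h, -⟩ | ⟨h, -⟩ <;> rw [h]
  · refine h₂.trans ?_
    rw [neg_mul]; gcongr; exact le_max_right _ _
  · refine h₁.trans ?_
    rw [mul_neg, neg_neg]; gcongr; exact le_max_left _ _

/-- The line `Re z = a` gives a bound by a multiple of `e^{ar}`; take `a = A` and `a = -A`. Since
`A` is arbitrary, the kernel beats the growth of any group. -/
theorem exists_abs_gaussKer_le {c : ℝ} (hc : 0 < c) (k : ℕ) (A : ℝ) :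
    ∃ C, 0 ≤ C ∧ ∀ r, |gaussKer c k r| ≤ C * Real.exp (-(A * |r|)) := by
  have key : ∀ a r, |gaussKer c k r| ≤
      ((2 * Real.pi)⁻¹ * ∫ y, lineWeight c k a y) * Real.exp (a * r) := by
    intro a r
    have h : |gaussKer c k r| = ‖(gaussKer c k r : ℂ)‖ := by simp
    rw [h, ofReal_gaussKer hc k a, norm_mul, mul_assoc]
    have h2 : ‖(2 * Real.pi : ℂ)⁻¹‖ = (2 * Real.pi)⁻¹ := by
      simp [abs_of_pos Real.pi_pos]
    rw [h2, ← integral_mul_const]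
    gcongr
    refine norm_integral_le_of_norm_le ((integrable_lineWeight hc k a).mul_const _)
      (Eventually.of_forall fun y => (norm_pow_mul_lineExp c k a r y).le)
  have hn : ∀ a, 0 ≤ (2 * Real.pi)⁻¹ * ∫ y, lineWeight c k a y := fun a =>
    mul_nonneg (by positivity) (integral_nonneg (lineWeight_nonneg c k a))
  exact ⟨_, (hn A).trans (le_max_left _ _), fun r =>
    le_max_mul_exp_neg_abs (key A r) (key (-A) r)⟩

/-! ### Strongly continuous groups: smoothing, resolvent and closedness of the generator -/

theorem integrable_exp_neg_mul_abs {b : ℝ} (hb : 0 < b) :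
    Integrable fun t : ℝ => Real.exp (-(b * |t|)) := by
  rw [← integrableOn_univ, ← Set.Iic_union_Ioi (a := (0 : ℝ))]
  refine IntegrableOn.union ?_ ?_
  · refine (integrableOn_exp_mul_Iic hb 0).congr_fun (fun t ht => ?_) measurableSet_Iic
    simp only
    rw [abs_of_nonpos ht, mul_neg, neg_neg]
  · refine (exp_neg_integrableOn_Ioi 0 hb).congr_fun (fun t ht => ?_) measurableSet_Ioi
    simp only
    rw [abs_of_pos ht, neg_mul]

section Group

variable {V : Type*} [NormedAddCommGroup V] [NormedSpace ℝ V] [Module ℍᵐᵒᵖ V]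

/-- The operators of the group as real linear operators. -/
noncomputable def realOp (U : StronglyContGroup V) (t : ℝ) : V →L[ℝ] V :=
  AddMonoidHom.toRealLinearMap ((U t : V →ₗ[ℍᵐᵒᵖ] V) : V →+ V) (U t).continuous

/-- Continuous additive maps are real linear, so no compatibility of the real and right quaternionic
scalars is required. -/
theorem group_smul (U : StronglyContGroup V) (t r : ℝ) (v : V) : U t (r • v) = r • U t v :=
  (realOp U t).map_smul r v

omit [NormedSpace ℝ V] in
theorem group_add_apply (U : StronglyContGroup V) (s t : ℝ) (v : V) :
    U (s + t) v = U s (U t v) := by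
  rw [U.map_add]; rfl

omit [NormedSpace ℝ V] in
theorem group_zero_apply (U : StronglyContGroup V) (v : V) : U 0 v = v := by
  rw [U.map_zero]; rfl

theorem group_integral [CompleteSpace V] (U : StronglyContGroup V) (s : ℝ) {X : Type*}
    [MeasurableSpace X] {ν : Measure X} {φ : X → V} (hφ : Integrable φ ν) :
    U s (∫ x, φ x ∂ν) = ∫ x, U s (φ x) ∂ν :=
  ((realOp U s).integral_comp_comm hφ).symm

/-- `w = T v` for the infinitesimal generator `T`. -/
def IsGen (U : StronglyContGroup V) (v w : V) : Prop :=
  Tendsto (diffQuot U v) (𝓝[>] 0) (𝓝 w)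

theorem isGen_of_hasDerivAt (U : StronglyContGroup V) {v w : V}
    (h : HasDerivAt (fun t => U t v) w 0) : IsGen U v w := by
  refine h.tendsto_slope_zero_right.congr fun t => ?_
  rw [zero_add, group_zero_apply, diffQuot]

section generator

variable [NormSMulClass ℍᵐᵒᵖ V] [SMulCommClass ℝ ℍᵐᵒᵖ V]

theorem isGen_generator (U : StronglyContGroup V) (v : (generator U).domain) :
    IsGen U v (generator U v) :=
  Exists.choose_spec (p := fun w => Tendsto (diffQuot U (v : V)) (𝓝[>] 0) (𝓝 w)) v.2

theorem IsGen.mem_domain {U : StronglyContGroup V} {v w : V} (h : IsGen U v w) :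
    v ∈ (generator U).domain := ⟨w, h⟩

theorem IsGen.generator_eq {U : StronglyContGroup V} {v w : V} (h : IsGen U v w)
    (hv : v ∈ (generator U).domain) : generator U ⟨v, hv⟩ = w :=
  tendsto_nhds_unique (isGen_generator U ⟨v, hv⟩) h

end generator

/-- An operator commuting with the group commutes with its generator. -/
theorem IsGen.map {U : StronglyContGroup V} {v w : V} (h : IsGen U v w) (R : V →L[ℝ] V)
    (hR : ∀ t x, U t (R x) = R (U t x)) : IsGen U (R v) (R w) := by
  refine ((R.continuous.tendsto w).comp h).congr fun t => ?_
  simp [diffQuot, hR]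

section Growth

variable {U : StronglyContGroup V} {ω K : ℝ}

theorem integrable_smul_orbit (hU : ∀ t v, ‖U t v‖ ≤ K * Real.exp (ω * |t|) * ‖v‖) {φ : ℝ → ℝ}
    (hφ : AEStronglyMeasurable φ volume) {A C : ℝ} (hA : ω < A)
    (hb : ∀ t, |φ t| ≤ C * Real.exp (-(A * |t|))) (v : V) :
    Integrable fun t => φ t • U (-t) v := by
  refine ((integrable_exp_neg_mul_abs (sub_pos.2 hA)).const_mul (C * K * ‖v‖)).mono'
    (hφ.smul ((U.continuous_orbit v).comp continuous_neg).aestronglyMeasurable)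
    (Eventually.of_forall fun t => ?_)
  rw [norm_smul, Real.norm_eq_abs]
  calc |φ t| * ‖U (-t) v‖ ≤ (C * Real.exp (-(A * |t|))) * (K * Real.exp (ω * |-t|) * ‖v‖) :=
        mul_le_mul (hb t) (hU _ _) (norm_nonneg _) ((abs_nonneg _).trans (hb t))
    _ = C * K * ‖v‖ * (Real.exp (-(A * |t|)) * Real.exp (ω * |t|)) := by rw [abs_neg]; ring
    _ = _ := by rw [← Real.exp_add]; ring_nf

/-- The smoothing operator `u ↦ ∫ g(t) U(-t) u dt`, `g` the `k`-th derivative of a heat kernel. -/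
noncomputable def smoothing (U : StronglyContGroup V) (c : ℝ) (k : ℕ) (u : V) : V :=
  ∫ t, gaussKer c k t • U (-t) u

theorem integrable_gaussKer_smul (hU : ∀ t v, ‖U t v‖ ≤ K * Real.exp (ω * |t|) * ‖v‖) {c : ℝ}
    (hc : 0 < c) (k : ℕ) (u : V) : Integrable fun t => gaussKer c k t • U (-t) u := by
  obtain ⟨C, -, hC⟩ := exists_abs_gaussKer_le hc k (ω + 1)
  exact integrable_smul_orbit hU (continuous_gaussKer hc k).aestronglyMeasurable
    (lt_add_one ω) hC u

variable [CompleteSpace V]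

/-- The translation is moved from the orbit, which is merely continuous, to the smooth kernel. -/
theorem group_smoothing (hU : ∀ t v, ‖U t v‖ ≤ K * Real.exp (ω * |t|) * ‖v‖) {c : ℝ}
    (hc : 0 < c) (k : ℕ) (u : V) (h : ℝ) :
    U h (smoothing U c k u) = ∫ t, gaussKer c k (t + h) • U (-t) u := by
  rw [smoothing, group_integral U h (integrable_gaussKer_smul hU hc k u),
    ← integral_add_right_eq_self (fun t => U h (gaussKer c k t • U (-t) u)) h]
  congr 1 with t
  rw [group_smul, ← group_add_apply]
  ring_nf

theorem isGen_smoothing (hU : ∀ t v, ‖U t v‖ ≤ K * Real.exp (ω * |t|) * ‖v‖) {c : ℝ}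
    (hc : 0 < c) (k : ℕ) (u : V) : IsGen U (smoothing U c k u) (smoothing U c (k + 1) u) := by
  apply isGen_of_hasDerivAt
  simp_rw [group_smoothing hU hc]
  obtain ⟨C, hC0, hC⟩ := exists_abs_gaussKer_le hc (k + 1) (|ω| + 1)
  have hcont : ∀ k h, AEStronglyMeasurable (fun t => gaussKer c k (t + h) • U (-t) u) volume :=
    fun k h => (((continuous_gaussKer hc k).comp (continuous_add_const h)).smul
      ((U.continuous_orbit u).comp continuous_neg)).aestronglyMeasurable
  have key := hasDerivAt_integral_of_dominated_loc_of_deriv_le (s := Metric.ball (0 : ℝ) 1)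
    (F := fun h t => gaussKer c k (t + h) • U (-t) u)
    (F' := fun h t => gaussKer c (k + 1) (t + h) • U (-t) u)
    -- A shift by `|h| < 1` costs at most the factor `e^{|ω|+1}`.
    (bound := fun t => ‖(C * Real.exp (|ω| + 1) * Real.exp (-((|ω| + 1) * |t|))) • U (-t) u‖)
    (μ := volume) (x₀ := (0 : ℝ))
    (Metric.ball_mem_nhds 0 one_pos) (Eventually.of_forall (hcont k))
    (by simpa using integrable_gaussKer_smul hU hc k u) (hcont (k + 1) 0)
    (Eventually.of_forall fun t h hh => ?_) ?_ (Eventually.of_forall fun t h _ => ?_)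
  · simpa [smoothing] using key.2
  · rw [norm_smul, norm_smul]
    gcongr
    rw [Real.norm_eq_abs, Real.norm_of_nonneg (by positivity), mul_assoc, ← Real.exp_add]
    refine (hC _).trans ?_
    gcongr
    have h1 : |h| ≤ 1 := by simpa using (mem_ball_zero_iff.1 hh).le
    have h2 : |t| ≤ |t + h| + |h| := by simpa using abs_sub (t + h) h
    have h3 := abs_nonneg ω
    nlinarith
  · refine (integrable_smul_orbit hU (C := C * Real.exp (|ω| + 1)) (A := |ω| + 1)
      (by fun_prop) ((le_abs_self ω).trans_lt (lt_add_one _)) (fun t => ?_) u).norm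
    rw [abs_of_nonneg (by positivity)]
  · have h1 : HasDerivAt (fun h => gaussKer c k (t + h)) (gaussKer c (k + 1) (t + h)) h := by
      simpa using (hasDerivAt_gaussKer hc k (t + h)).comp_const_add t h
    exact h1.smul_const _

theorem integral_gaussKer_one : ∫ t, gaussKer 1 0 t = 1 := by
  simp_rw [gaussKer_zero]
  rw [integral_const_mul]
  have h : ∀ t : ℝ, -t ^ 2 / (4 * 1) = -(1 / 4) * t ^ 2 := fun t => by ring
  simp_rw [h]
  rw [integral_gaussian, mul_one, div_div_eq_mul_div, div_one, Real.sqrt_mul Real.pi_pos.le,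
    show (4 : ℝ) = 2 ^ 2 by norm_num, Real.sqrt_sq (by norm_num)]
  have := Real.sqrt_pos.2 Real.pi_pos
  field_simp

omit [CompleteSpace V] in
-- Rescaling fixes the kernel and puts the parameter into the group, where `σ → 0` is strong
-- continuity.
theorem smoothing_sq {σ : ℝ} (hσ : 0 < σ) (U : StronglyContGroup V) (u : V) :
    smoothing U (σ ^ 2) 0 u = ∫ t, gaussKer 1 0 t • U (-(σ * t)) u := by
  have h := Measure.integral_comp_mul_left (fun t => gaussKer (σ ^ 2) 0 t • U (-t) u) σ
  rw [abs_of_pos (inv_pos.2 hσ), eq_inv_smul_iff₀ hσ.ne', ← integral_smul] at h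
  rw [smoothing, ← h]
  congr 1 with t
  rw [smul_smul, gaussKer_zero, gaussKer_zero]
  congr 1
  rw [Real.sqrt_mul Real.pi_pos.le, Real.sqrt_sq hσ.le, mul_one]
  have h1 : -(σ * t) ^ 2 / (4 * σ ^ 2) = -t ^ 2 / (4 * 1) := by field_simp
  have := Real.sqrt_pos.2 Real.pi_pos
  rw [h1]
  field_simp

theorem exists_smoothing_tendsto (hU : ∀ t v, ‖U t v‖ ≤ K * Real.exp (ω * |t|) * ‖v‖) :
    ∃ c : ℕ → ℝ, (∀ j, 0 < c j) ∧
      ∀ u, Tendsto (fun j => smoothing U (c j) 0 u) atTop (𝓝 u) := by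
  refine ⟨fun j => (1 / ((j : ℝ) + 1)) ^ 2, fun j => by positivity, fun u => ?_⟩
  have hσ : ∀ j : ℕ, 0 < 1 / ((j : ℝ) + 1) := fun j => by positivity
  simp_rw [smoothing_sq (hσ _)]
  have hlim : u = ∫ t, gaussKer 1 0 t • u := by
    rw [integral_smul_const, integral_gaussKer_one, one_smul]
  conv => rhs; rw [hlim]
  obtain ⟨C, hC0, hC⟩ := exists_abs_gaussKer_le one_pos 0 (|ω| + 1)
  have hK : ∀ s, ‖U s u‖ ≤ |K| * Real.exp (|ω| * |s|) * ‖u‖ := fun s => (hU s u).trans (by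
    gcongr <;> exact le_abs_self _)
  refine tendsto_integral_of_dominated_convergence
    (fun t => C * |K| * ‖u‖ * Real.exp (-(1 * |t|))) (fun j => ?_)
    ((integrable_exp_neg_mul_abs one_pos).const_mul _) (fun j => Eventually.of_forall fun t => ?_)
    (Eventually.of_forall fun t => ?_)
  · exact ((continuous_gaussKer one_pos 0).smul
      ((U.continuous_orbit u).comp (by fun_prop))).aestronglyMeasurable
  · rw [norm_smul, Real.norm_eq_abs]
    have h1 : |-(1 / ((j : ℝ) + 1) * t)| ≤ |t| := by
      rw [abs_neg, abs_mul, abs_of_pos (hσ j)]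
      refine mul_le_of_le_one_left (abs_nonneg t) ?_
      rw [div_le_one (by positivity)]
      linarith [(Nat.cast_nonneg j : (0 : ℝ) ≤ j)]
    calc |gaussKer 1 0 t| * ‖U (-(1 / ((j : ℝ) + 1) * t)) u‖
        ≤ (C * Real.exp (-((|ω| + 1) * |t|))) * (|K| * Real.exp (|ω| * |t|) * ‖u‖) := by
          refine mul_le_mul (hC t) ((hK _).trans ?_) (norm_nonneg _) (by positivity)
          gcongr
      _ = C * |K| * ‖u‖ * (Real.exp (-((|ω| + 1) * |t|)) * Real.exp (|ω| * |t|)) := by ring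
      _ = _ := by rw [← Real.exp_add]; ring_nf
  · have h1 : Tendsto (fun j : ℕ => -(1 / ((j : ℝ) + 1) * t)) atTop (𝓝 0) := by
      simpa using (tendsto_one_div_add_atTop_nhds_zero_nat.mul_const t).neg
    have h2 := ((U.continuous_orbit u).tendsto 0).comp h1
    rw [group_zero_apply] at h2
    exact h2.const_smul _

/-- There is a bounded operator inverting `ω + 1 - T`. -/
theorem exists_resolvent (hU : ∀ t v, ‖U t v‖ ≤ K * Real.exp (ω * |t|) * ‖v‖) :
    ∃ R : V →L[ℝ] V, (∀ v w, IsGen U v w → R ((ω + 1) • v - w) = v) ∧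
      ∀ v, IsGen U (R v) ((ω + 1) • R v - v) := by
  have hcont : ∀ v, Continuous fun t => Real.exp (-((ω + 1) * t)) • U t v := fun v =>
    Continuous.smul (by fun_prop) (U.continuous_orbit v)
  have hbd : ∀ v, ∀ t ∈ Set.Ioi (0 : ℝ), ‖Real.exp (-((ω + 1) * t)) • U t v‖ ≤
      K * ‖v‖ * Real.exp (-1 * t) := by
    intro v t ht
    rw [norm_smul, Real.norm_of_nonneg (Real.exp_pos _).le]
    calc Real.exp (-((ω + 1) * t)) * ‖U t v‖
        ≤ Real.exp (-((ω + 1) * t)) * (K * Real.exp (ω * |t|) * ‖v‖) := by gcongr; exact hU t v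
      _ = K * ‖v‖ * (Real.exp (-((ω + 1) * t)) * Real.exp (ω * t)) := by
          rw [abs_of_pos ht]; ring
      _ = _ := by rw [← Real.exp_add]; ring_nf
  have hexp := exp_neg_integrableOn_Ioi 0 one_pos
  have hint0 : ∀ v, IntegrableOn (fun t => Real.exp (-((ω + 1) * t)) • U t v) (Set.Ioi 0) :=
    fun v => (hexp.const_mul (K * ‖v‖)).mono' (hcont v).aestronglyMeasurable
      (ae_restrict_of_forall_mem measurableSet_Ioi (hbd v))
  have hint : ∀ v a, IntegrableOn (fun t => Real.exp (-((ω + 1) * t)) • U t v) (Set.Ioi a) := by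
    intro v a
    rcases le_total 0 a with ha | ha
    · exact (hint0 v).mono_set (Set.Ioi_subset_Ioi ha)
    · rw [← Set.Ioc_union_Ioi_eq_Ioi ha]
      exact ((hcont v).integrableOn_Icc.mono_set Set.Ioc_subset_Icc_self).union (hint0 v)
  let R₀ : V →ₗ[ℝ] V :=
    { toFun := fun v => ∫ t in Set.Ioi (0 : ℝ), Real.exp (-((ω + 1) * t)) • U t v
      map_add' := fun v w => by
        rw [← integral_add (hint0 v) (hint0 w)]; simp
      map_smul' := fun r v => by
        simp only [RingHom.id_apply]
        rw [← integral_smul]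
        simp_rw [group_smul, smul_comm r] }
  let R : V →L[ℝ] V := R₀.mkContinuous (K * ∫ t in Set.Ioi (0 : ℝ), Real.exp (-1 * t)) (by
    intro v
    calc ‖R₀ v‖ ≤ ∫ t in Set.Ioi (0 : ℝ), K * ‖v‖ * Real.exp (-1 * t) :=
          norm_integral_le_of_norm_le (hexp.const_mul _)
            (ae_restrict_of_forall_mem measurableSet_Ioi (hbd v))
      _ = _ := by rw [integral_const_mul]; ring)
  have hR : ∀ v, R v = ∫ t in Set.Ioi (0 : ℝ), Real.exp (-((ω + 1) * t)) • U t v := fun _ => rfl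
  have hcomm : ∀ h v, U h (R v) = R (U h v) := by
    intro h v
    rw [hR, hR, group_integral U h (hint0 v)]
    congr 1 with t
    rw [group_smul, ← group_add_apply, ← group_add_apply, add_comm t h]
  have hgen : ∀ v, IsGen U (R v) ((ω + 1) • R v - v) := by
    intro v
    apply isGen_of_hasDerivAt
    -- Translation in the Laplace integral: only the integral from `0` to `h` is lost, up to the
    -- factor `e^{(ω+1)h}`.
    have hform : ∀ h, U h (R v) = Real.exp ((ω + 1) * h) •
        (R v - ∫ t in (0 : ℝ)..h, Real.exp (-((ω + 1) * t)) • U t v) := by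
      intro h
      have h1 := intervalIntegral.integral_interval_add_Ioi (hint0 v) (hint v h)
      rw [hcomm, hR (U h v), hR v, ← h1, add_sub_cancel_left]
      have h2 := (measurePreserving_add_right volume h).setIntegral_preimage_emb
        (measurableEmbedding_addRight h) (fun t => Real.exp (-((ω + 1) * t)) • U t v) (Set.Ioi h)
      rw [← h2, ← integral_smul]
      have h3 : (fun x => x + h) ⁻¹' Set.Ioi h = Set.Ioi 0 := by ext; simp
      rw [h3]
      congr 1 with t
      rw [smul_smul, ← Real.exp_add, group_add_apply]
      ring_nf
    simp_rw [hform]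
    have h1 : HasDerivAt (fun h => ∫ t in (0 : ℝ)..h, Real.exp (-((ω + 1) * t)) • U t v)
        v 0 := by
      have := intervalIntegral.integral_hasDerivAt_right
        ((hcont v).intervalIntegrable (0 : ℝ) 0 (μ := volume))
        ((hcont v).stronglyMeasurableAtFilter _ _) (hcont v).continuousAt
      simpa [group_zero_apply] using this
    have h2 : HasDerivAt (fun h : ℝ => Real.exp ((ω + 1) * h)) (ω + 1) 0 := by
      simpa using ((hasDerivAt_id (0 : ℝ)).const_mul (ω + 1)).exp
    have h3 := h2.smul (h1.const_sub (R v))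
    refine h3.congr_deriv ?_
    simp
    abel
  refine ⟨R, fun v w h => ?_, hgen⟩
  -- `R` commutes with the group, so `T R v = R w`; `hgen` computes the same vector as `(ω + 1) R v
  -- - v`.
  have h1 : R w = (ω + 1) • R v - v := tendsto_nhds_unique (h.map R hcomm) (hgen v)
  rw [map_sub, map_smul, h1, sub_sub_cancel]

/-- The generator is closed. -/
theorem isGen_of_tendsto (hU : ∀ t v, ‖U t v‖ ≤ K * Real.exp (ω * |t|) * ‖v‖)
    {v w : ℕ → V} {v₀ w₀ : V} (h : ∀ j, IsGen U (v j) (w j)) (hv : Tendsto v atTop (𝓝 v₀))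
    (hw : Tendsto w atTop (𝓝 w₀)) : IsGen U v₀ w₀ := by
  obtain ⟨R, h1, h2⟩ := exists_resolvent hU
  -- In resolvent form the relation `w = T v` involves only a bounded operator, so it survives
  -- limits.
  have h3 : v₀ = R ((ω + 1) • v₀ - w₀) := by
    refine tendsto_nhds_unique hv ?_
    refine ((R.continuous.tendsto _).comp ((hv.const_smul (ω + 1)).sub hw)).congr fun j => ?_
    exact h1 _ _ (h j)
  have h4 := h2 ((ω + 1) • v₀ - w₀)
  rwa [← h3, sub_sub_cancel] at h4

end Growth

end Group

/-! ### Intrinsic transforms have real measures, intrinsic polynomials have real coefficients -/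

/-- The finite measures `g⁺ dν` and `g⁻ dν` have the same characteristic function, hence coincide.
-/
theorem ae_eq_zero_of_integral_cos_sin_eq_zero {ν : Measure ℝ} {g : ℝ → ℝ} (hg : Integrable g ν)
    (hcos : ∀ y, ∫ t, Real.cos (t * y) * g t ∂ν = 0)
    (hsin : ∀ y, ∫ t, Real.sin (t * y) * g t ∂ν = 0) : g =ᵐ[ν] 0 := by
  have hfin : ∀ {g : ℝ → ℝ}, Integrable g ν →
      IsFiniteMeasure (ν.withDensity fun t => ENNReal.ofReal (g t)) := fun hg =>
    isFiniteMeasure_withDensity_ofReal hg.2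
  have := hfin hg
  have := hfin hg.neg
  have hbd : ∀ y t : ℝ, ‖Complex.exp (y * t * Complex.I)‖ ≤ 1 := fun y t => by
    rw [← Complex.ofReal_mul, Complex.norm_exp_ofReal_mul_I]
  have hchar : ∀ {g : ℝ → ℝ}, Integrable g ν → ∀ y,
      charFun (ν.withDensity fun t => ENNReal.ofReal (g t)) y =
        ∫ t, ((max (g t) 0 : ℝ) : ℂ) * Complex.exp (y * t * Complex.I) ∂ν := by
    intro g hg y
    rw [charFun_apply_real, integral_withDensity_eq_integral_toReal_smul₀
      hg.aestronglyMeasurable.aemeasurable.ennreal_ofReal (by simp)]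
    simp [ENNReal.toReal_ofReal']
  have hmi : ∀ {g : ℝ → ℝ}, Integrable g ν → ∀ y : ℝ,
      Integrable (fun t => ((max (g t) 0 : ℝ) : ℂ) * Complex.exp (y * t * Complex.I)) ν := by
    intro g hg y
    exact hg.pos_part.ofReal.mul_bdd (c := 1) (by fun_prop) (Eventually.of_forall (hbd y))
  have heq : (ν.withDensity fun t => ENNReal.ofReal (g t)) =
      ν.withDensity fun t => ENNReal.ofReal (-g t) := by
    refine Measure.ext_of_charFun (funext fun y => ?_)
    rw [hchar hg, show (fun t => ENNReal.ofReal (-g t)) = fun t => ENNReal.ofReal ((-g) t) from rfl,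
      hchar hg.neg, ← sub_eq_zero, ← integral_sub (hmi hg y) (hmi hg.neg y)]
    have h1 : ∀ t : ℝ, ((max (g t) 0 : ℝ) : ℂ) * Complex.exp (y * t * Complex.I) -
        ((max (-g t) 0 : ℝ) : ℂ) * Complex.exp (y * t * Complex.I) =
        ((Real.cos (t * y) * g t : ℝ) : ℂ) + ((Real.sin (t * y) * g t : ℝ) : ℂ) * Complex.I := by
      intro t
      rw [← sub_mul, ← Complex.ofReal_sub, max_zero_sub_max_neg_zero_eq_self, mul_comm (y : ℂ),
        ← Complex.ofReal_mul, Complex.exp_mul_I]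
      push_cast; ring
    have hci : Integrable (fun t => Real.cos (t * y) * g t) ν :=
      hg.bdd_mul (c := 1) (by fun_prop) (Eventually.of_forall fun t => Real.abs_cos_le_one _)
    have hsi : Integrable (fun t => Real.sin (t * y) * g t) ν :=
      hg.bdd_mul (c := 1) (by fun_prop) (Eventually.of_forall fun t => Real.abs_sin_le_one _)
    simp only [Pi.neg_apply]
    simp_rw [h1]
    rw [integral_add hci.ofReal (hsi.ofReal.mul_const _), integral_mul_const, integral_complex_ofReal,
      integral_complex_ofReal, hcos, hsin]
    simp
  have hm := hg.aestronglyMeasurable.aemeasurable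
  have heq := (withDensity_eq_iff hm.ennreal_ofReal hm.neg.ennreal_ofReal
    hg.lintegral_lt_top.ne).1 heq
  filter_upwards [heq] with t ht
  have h1 : max (g t) 0 = max (-g t) 0 := by
    simpa [ENNReal.toReal_ofReal'] using congrArg ENNReal.toReal ht
  rw [← max_zero_sub_max_neg_zero_eq_self (g t), h1, sub_self]; rfl

/-- The `i`-coordinate of a quaternion. -/
def imILin : ℍ →ₗ[ℝ] ℝ := QuaternionAlgebra.imIₗ (-1) 0 (-1)

@[simp] theorem imILin_apply (q : ℍ) : imILin q = q.imI := rfl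

/-- The `j`-coordinate of a quaternion. -/
def imJLin : ℍ →ₗ[ℝ] ℝ := QuaternionAlgebra.imJₗ (-1) 0 (-1)

@[simp] theorem imJLin_apply (q : ℍ) : imJLin q = q.imJ := rfl

/-- The `k`-coordinate of a quaternion. -/
def imKLin : ℍ →ₗ[ℝ] ℝ := QuaternionAlgebra.imKₗ (-1) 0 (-1)

@[simp] theorem imKLin_apply (q : ℍ) : imKLin q = q.imK := rfl

theorem exp_neg_smul_smul {I : ℍ} (hI : I.re = 0) (hI1 : ‖I‖ = 1) (t y : ℝ) :
    NormedSpace.exp (-(t • y • I)) = (Real.cos (t * y) : ℍ) - Real.sin (t * y) • I := by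
  rw [Quaternion.exp_of_re_eq_zero _ (by simp [hI])]
  have h1 : ‖-(t • y • I)‖ = |t * y| := by
    rw [norm_neg, norm_smul, norm_smul, hI1, mul_one, abs_mul]; rfl
  rw [h1, Real.cos_abs, smul_neg, smul_smul t y, smul_smul, ← sub_eq_add_neg]
  congr 2
  rcases abs_cases (t * y) with ⟨h, -⟩ | ⟨h, -⟩ <;> rw [h]
  · by_cases h0 : t * y = 0
    · simp [h0]
    · rw [div_mul_cancel₀ _ h0]
  · by_cases h0 : t * y = 0
    · simp [h0]
    · rw [Real.sin_neg, neg_div_neg_eq, div_mul_cancel₀ _ h0]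

theorem IsExpDensity.integrable {κ : ℝ} {ν : Measure ℝ} {θ : ℝ → ℍ} (h : IsExpDensity κ ν θ) :
    Integrable θ ν :=
  have := h.finite
  Integrable.of_bound h.measurable.aestronglyMeasurable 1 (Eventually.of_forall h.norm_le)

/-- For an imaginary unit `I`, `f(yI) = C(y) - S(y) I` with `C` and `S` the cosine and sine
transforms of `θ`. Intrinsicness forces `C(y)` real and `Re (S(y) I) = 0`; with `I = i, j, k` this
makes `S(y)` real. The imaginary coordinates of `θ` then have vanishing transforms. -/
theorem IsExpDensity.ae_eq_re {κ δ : ℝ} (hδ : 0 < δ) {ν : Measure ℝ} {θ : ℝ → ℍ}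
    (h : IsExpDensity κ ν θ) (hf : IsIntrinsicOn {s : ℍ | |s.re| < δ} (densFun ν θ)) :
    ∀ᵐ t ∂ν, θ t = ((θ t).re : ℍ) := by
  have hi := h.integrable
  have hci : ∀ y, Integrable (fun t => Real.cos (t * y) • θ t) ν := fun y =>
    hi.bdd_smul (φ := fun t => Real.cos (t * y)) 1
      (by fun_prop) (Eventually.of_forall fun t => Real.abs_cos_le_one _)
  have hsi : ∀ y, Integrable (fun t => Real.sin (t * y) • θ t) ν := fun y =>
    hi.bdd_smul (φ := fun t => Real.sin (t * y)) 1
      (by fun_prop) (Eventually.of_forall fun t => Real.abs_sin_le_one _)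
  set C : ℝ → ℍ := fun y => ∫ t, Real.cos (t * y) • θ t ∂ν with hC
  set S : ℝ → ℍ := fun y => ∫ t, Real.sin (t * y) • θ t ∂ν with hS
  have hval : ∀ I : ℍ, I.re = 0 → ‖I‖ = 1 → ∀ y, densFun ν θ (y • I) = C y - S y * I := by
    intro I hI hI1 y
    rw [densFun, hC, hS]
    simp only
    rw [← integral_mul_const_of_integrable (hsi y), ← integral_sub (hci y) ((hsi y).mul_const I)]
    congr 1 with t : 1
    rw [exp_neg_smul_smul hI hI1, mul_sub, mul_smul_comm, smul_mul_assoc,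
      ← Quaternion.coe_commutes, Quaternion.coe_mul_eq_smul]
  have hCS : ∀ I : ℍ, I.re = 0 → ‖I‖ = 1 → ∀ y, C y = ((C y).re : ℍ) ∧ (S y * I).re = 0 := by
    intro I hI hI1 y
    have h1 := hf (y • I) (by simp [hI, hδ])
    have hstar : star I = -I := by ext <;> simp [hI]
    have h2 : star (y • I) = (-y) • I := by ext <;> simp [hI]
    have hC' : C (-y) = C y := by simp [hC]
    have hS' : S (-y) = -S y := by simp [hS, integral_neg]
    rw [h2, hval I hI hI1, hval I hI hI1, hC', hS'] at h1
    have hre := congrArg (fun q : ℍ => q.re) h1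
    have hI' := congrArg (fun q : ℍ => q.imI) h1
    have hJ' := congrArg (fun q : ℍ => q.imJ) h1
    have hK' := congrArg (fun q : ℍ => q.imK) h1
    simp only [star_sub, neg_mul, sub_neg_eq_add, Quaternion.re_add, Quaternion.imI_add,
      Quaternion.imJ_add, Quaternion.imK_add, Quaternion.re_sub, Quaternion.imI_sub,
      Quaternion.imJ_sub, Quaternion.imK_sub, Quaternion.re_star, Quaternion.imI_star,
      Quaternion.imJ_star, Quaternion.imK_star] at hre hI' hJ' hK'
    refine ⟨?_, by linarith⟩
    ext <;> simp <;> linarith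
  have hnorm : ∀ q : ℍ, q.re ^ 2 + q.imI ^ 2 + q.imJ ^ 2 + q.imK ^ 2 = 1 → ‖q‖ = 1 := by
    intro q hq
    rw [← sq_eq_sq₀ (norm_nonneg _) zero_le_one, pow_two, ← Quaternion.normSq_eq_norm_mul_self,
      Quaternion.normSq_def', hq, one_pow]
  obtain ⟨i₀, hi₀, hi₁, hi₂⟩ : ∃ i : ℍ, i.re = 0 ∧ ‖i‖ = 1 ∧ ∀ q : ℍ, (q * i).re = -q.imI :=
    ⟨⟨0, 1, 0, 0⟩, rfl, hnorm _ (by norm_num), fun q => (Quaternion.re_mul _ _).trans (by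
      change q.re * 0 - q.imI * 1 - q.imJ * 0 - q.imK * 0 = _; ring)⟩
  obtain ⟨j₀, hj₀, hj₁, hj₂⟩ : ∃ i : ℍ, i.re = 0 ∧ ‖i‖ = 1 ∧ ∀ q : ℍ, (q * i).re = -q.imJ :=
    ⟨⟨0, 0, 1, 0⟩, rfl, hnorm _ (by norm_num), fun q => (Quaternion.re_mul _ _).trans (by
      change q.re * 0 - q.imI * 0 - q.imJ * 1 - q.imK * 0 = _; ring)⟩
  obtain ⟨k₀, hk₀, hk₁, hk₂⟩ : ∃ i : ℍ, i.re = 0 ∧ ‖i‖ = 1 ∧ ∀ q : ℍ, (q * i).re = -q.imK :=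
    ⟨⟨0, 0, 0, 1⟩, rfl, hnorm _ (by norm_num), fun q => (Quaternion.re_mul _ _).trans (by
      change q.re * 0 - q.imI * 0 - q.imJ * 0 - q.imK * 1 = _; ring)⟩
  have key : ∀ φ : ℍ →L[ℝ] ℝ, (∀ r : ℝ, φ r = 0) →
      (∀ q : ℍ, (∀ I : ℍ, I.re = 0 → ‖I‖ = 1 → (q * I).re = 0) → φ q = 0) →
      ∀ᵐ t ∂ν, φ (θ t) = 0 := by
    intro φ h1 h2
    refine ae_eq_zero_of_integral_cos_sin_eq_zero (φ.integrable_comp hi) (fun y => ?_) fun y => ?_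
    · have h3 : φ (C y) = 0 := by
        rw [(hCS i₀ hi₀ hi₁ y).1, h1]
      rw [hC, ← φ.integral_comp_comm (hci y)] at h3
      simpa using h3
    · have h3 : φ (S y) = 0 := h2 _ fun I hI hI1 => (hCS I hI hI1 y).2
      rw [hS, ← φ.integral_comp_comm (hsi y)] at h3
      simpa using h3
  have hI := key (LinearMap.toContinuousLinearMap imILin) (fun r => by simp) fun q hq => by
    simpa [hi₂] using hq i₀ hi₀ hi₁
  have hJ := key (LinearMap.toContinuousLinearMap imJLin) (fun r => by simp) fun q hq => by
    simpa [hj₂] using hq j₀ hj₀ hj₁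
  have hK := key (LinearMap.toContinuousLinearMap imKLin) (fun r => by simp) fun q hq => by
    simpa [hk₂] using hq k₀ hk₀ hk₁
  filter_upwards [hI, hJ, hK] with t h1 h2 h3
  ext
  · simp
  · simpa using h1
  · simpa using h2
  · simpa using h3

open Polynomial in
-- At real points the values are fixed by conjugation, so each imaginary coordinate of the
-- coefficients forms a real polynomial vanishing on `ℝ`.
theorem IsIntrinsicPoly.exists_real {P : Polynomial ℍ} (hP : IsIntrinsicPoly P) :
    ∃ Q : ℝ[X], P = Q.map (algebraMap ℝ ℍ) := by
  have key : ∀ φ : ℍ →ₗ[ℝ] ℝ, (∀ r : ℝ, φ r = 0) → ∀ k, φ (P.coeff k) = 0 := by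
    intro φ hφ k
    let Q : ℝ[X] := ∑ k ∈ Finset.range (P.natDegree + 1), C (φ (P.coeff k)) * X ^ k
    have hQ : Q = 0 := by
      refine Polynomial.funext fun x => ?_
      have h1 := hP (x : ℍ) trivial
      simp only [Quaternion.star_coe] at h1
      rw [eq_comm, Quaternion.star_eq_self] at h1
      have h2 : eval x Q = φ (P.eval (x : ℍ)) := by
        rw [eval_eq_sum_range (p := P), map_sum, eval_finsetSum]
        refine Finset.sum_congr rfl fun k _ => ?_
        rw [← Quaternion.coe_pow, Quaternion.mul_coe_eq_smul, map_smul]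
        rw [eval_mul, eval_C, eval_pow, eval_X, smul_eq_mul, mul_comm]
      rw [h2, h1, hφ, eval_zero]
    have h2 : Q.coeff k = if k < P.natDegree + 1 then φ (P.coeff k) else 0 := by
      simp [Q, coeff_C_mul, coeff_X_pow]
    rw [hQ, coeff_zero] at h2
    split_ifs at h2 with h3
    · exact h2.symm
    · rw [coeff_eq_zero_of_natDegree_lt (by omega), map_zero]
  have h : P ∈ lifts (algebraMap ℝ ℍ) := by
    rw [lifts_iff_coeff_lifts]
    intro k
    refine ⟨(P.coeff k).re, ?_⟩
    have hI := key imILin (fun r => by simp) k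
    have hJ := key imJLin (fun r => by simp) k
    have hK := key imKLin (fun r => by simp) k
    rw [imILin_apply] at hI
    rw [imJLin_apply] at hJ
    rw [imKLin_apply] at hK
    ext <;> simp [hI, hJ, hK]
  obtain ⟨Q, hQ⟩ := (mem_lifts P).1 h
  exact ⟨Q, hQ.symm⟩

/-! ### Convolutions with heat kernels and line integrals of transforms -/

theorem continuous_ofComplex : Continuous Quaternion.ofComplex :=
  Quaternion.ofComplex.toLinearMap.continuous_of_finiteDimensional

theorem norm_ofComplex (z : ℂ) : ‖Quaternion.ofComplex z‖ = ‖z‖ := by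
  rw [← sq_eq_sq₀ (norm_nonneg _) (norm_nonneg _), pow_two,
    ← Quaternion.normSq_eq_norm_mul_self, Quaternion.normSq_def', Complex.sq_norm,
    Complex.normSq_apply]
  simp [pow_two]

theorem ofComplex_ofReal (x : ℝ) : Quaternion.ofComplex (x : ℂ) = (x : ℍ) := by
  simp

theorem exp_neg_smul_ofComplex (t : ℝ) (z : ℂ) :
    NormedSpace.exp (-(t • Quaternion.ofComplex z)) =
      Quaternion.ofComplex (Complex.exp (-(t * z))) := by
  let _ : NormedAlgebra ℚ ℂ := NormedAlgebra.restrictScalars ℚ ℝ ℂ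
  rw [Complex.exp_eq_exp_ℂ, NormedSpace.map_exp Quaternion.ofComplex continuous_ofComplex, map_neg,
    ← Complex.real_smul, map_smul]

theorem ofComplex_re (z : ℂ) : (Quaternion.ofComplex z).re = z.re := by
  simp [Quaternion.coe_ofComplex]

theorem lineExp_sub (c a r t y : ℝ) :
    lineExp c a (r - t) y = Complex.exp (-(t * linePt a y)) * lineExp c a r y := by
  rw [lineExp, lineExp, ← Complex.exp_add]
  congr 1; push_cast; ring

/-- The convolution of a density with a derivative of a heat kernel. -/
noncomputable def heatConv (c : ℝ) (k : ℕ) (ν : Measure ℝ) (θ : ℝ → ℍ) (r : ℝ) : ℍ :=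
  ∫ t, gaussKer c k (r - t) • θ t ∂ν

section heatConv

variable {κ c a : ℝ} {ν : Measure ℝ} {θ : ℝ → ℍ}

theorem integrable_prod_line (h : IsExpDensity κ ν θ) (hc : 0 < c) (ha : |a| ≤ κ) (k : ℕ) (r : ℝ) :
    Integrable (fun p : ℝ × ℝ => θ p.1 * NormedSpace.exp (-(p.1 • Quaternion.ofComplex
      (linePt a p.2))) * Quaternion.ofComplex (linePt a p.2 ^ k * lineExp c a r p.2))
      (ν.prod volume) := by
  have := h.finite
  have hb := h.moment.mul_prod ((integrable_lineWeight hc k a).mul_const (Real.exp (a * r)))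
  have h1 : Continuous fun p : ℝ × ℝ => Quaternion.ofComplex (Complex.exp (-(p.1 * linePt a p.2))) :=
    continuous_ofComplex.comp (by fun_prop)
  have h2 : Continuous fun p : ℝ × ℝ =>
      Quaternion.ofComplex (linePt a p.2 ^ k * lineExp c a r p.2) :=
    continuous_ofComplex.comp ((((continuous_linePt a).comp continuous_snd).pow k).mul
      ((continuous_lineExp c a r).comp continuous_snd))
  refine hb.mono' ?_ (Eventually.of_forall fun p => ?_)
  · simp_rw [exp_neg_smul_ofComplex]
    exact ((h.measurable.comp_measurable measurable_fst).aestronglyMeasurable.mul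
      h1.aestronglyMeasurable).mul h2.aestronglyMeasurable
  · rw [norm_mul, norm_mul, norm_exp_neg_smul, norm_ofComplex, norm_pow_mul_lineExp, ofComplex_re,
      linePt_re]
    have h3 := h.norm_le p.1
    have h4 := exp_neg_mul_le ha p.1
    have h5 := lineWeight_nonneg c k a p.2
    calc ‖θ p.1‖ * Real.exp (-(p.1 * a)) * (lineWeight c k a p.2 * Real.exp (a * r))
        ≤ 1 * Real.exp (κ * |p.1|) * (lineWeight c k a p.2 * Real.exp (a * r)) := by gcongr
      _ = _ := by rw [one_mul]

theorem integrable_density_mul_exp (h : IsExpDensity κ ν θ) {s : ℍ} (hs : |s.re| ≤ κ) :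
    Integrable (fun t => θ t * NormedSpace.exp (-(t • s))) ν := by
  refine h.moment.mono' (h.measurable.aestronglyMeasurable.mul
    (continuous_exp_neg_smul s).aestronglyMeasurable) (Eventually.of_forall fun t => ?_)
  rw [norm_mul, norm_exp_neg_smul, ← one_mul (Real.exp (κ * |t|))]
  exact mul_le_mul (h.norm_le t) (exp_neg_mul_le hs t) (Real.exp_pos _).le zero_le_one

theorem integral_line_inner (h : IsExpDensity κ ν θ) (ha : |a| ≤ κ) (k : ℕ) (r y : ℝ) :
    ∫ t, θ t * NormedSpace.exp (-(t • Quaternion.ofComplex (linePt a y))) *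
      Quaternion.ofComplex (linePt a y ^ k * lineExp c a r y) ∂ν =
    densFun ν θ (Quaternion.ofComplex (linePt a y)) *
      Quaternion.ofComplex (linePt a y ^ k * lineExp c a r y) := by
  rw [integral_mul_const_of_integrable (integrable_density_mul_exp h (by
    rwa [ofComplex_re, linePt_re])), densFun]

theorem integrable_densFun_line (h : IsExpDensity κ ν θ) (hc : 0 < c) (ha : |a| ≤ κ) (k : ℕ)
    (r : ℝ) : Integrable fun y => densFun ν θ (Quaternion.ofComplex (linePt a y)) *
      Quaternion.ofComplex (linePt a y ^ k * lineExp c a r y) := by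
  have := h.finite
  exact (integrable_prod_line h hc ha k r).integral_prod_right.congr
    (Eventually.of_forall fun y => integral_line_inner h ha k r y)

/-- Insert the line integral for `g⁽ᵏ⁾(r - t)`, split off `e^{-tz}` and exchange integrals: the
integral over `t` is the transform at `z`. The factor `zᵏ` stands to the right of it. -/
theorem heatConv_eq_line (h : IsExpDensity κ ν θ) (hc : 0 < c) (ha : |a| ≤ κ) (k : ℕ) (r : ℝ) :
    heatConv c k ν θ r = (2 * Real.pi)⁻¹ • ∫ y, densFun ν θ (Quaternion.ofComplex (linePt a y)) *
      Quaternion.ofComplex (linePt a y ^ k * lineExp c a r y) := by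
  have := h.finite
  simp_rw [← integral_line_inner h ha]
  rw [← integral_integral_swap (integrable_prod_line h hc ha k r), ← integral_smul, heatConv]
  congr 1 with t : 1
  have h1 : (gaussKer c k (r - t) : ℍ) = (2 * Real.pi)⁻¹ •
      ∫ y, Quaternion.ofComplex (linePt a y ^ k * lineExp c a (r - t) y) := by
    have h2 := (Quaternion.ofComplex.toLinearMap.toContinuousLinearMap).integral_comp_comm
      (integrable_pow_mul_lineExp hc k a (r - t))
    have h3 := ofReal_gaussKer hc k a (r - t)
    have h4 : (2 * Real.pi : ℂ)⁻¹ * lineInt c k a (r - t) =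
        (2 * Real.pi)⁻¹ • lineInt c k a (r - t) := by
      rw [Complex.real_smul]; push_cast; rfl
    rw [← ofComplex_ofReal, h3, h4, map_smul]
    congr 1
    exact h2.symm
  have hint : Integrable fun y => Quaternion.ofComplex (linePt a y ^ k * lineExp c a (r - t) y) :=
    (Quaternion.ofComplex.toLinearMap.toContinuousLinearMap).integrable_comp
      (integrable_pow_mul_lineExp hc k a (r - t))
  rw [← Quaternion.mul_coe_eq_smul, h1, mul_smul_comm, ← integral_const_mul_of_integrable hint]
  congr 2 with y : 1
  rw [mul_assoc, exp_neg_smul_ofComplex, ← map_mul, lineExp_sub]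
  ring_nf

end heatConv

/-- `(2π)⁻¹ ∫ F(z) e^{cz² + rz} dy` over the line `z = a + iy`. -/
noncomputable def lineTransform (c : ℝ) (F : ℍ → ℍ) (a r : ℝ) : ℍ :=
  (2 * Real.pi)⁻¹ • ∫ y, F (Quaternion.ofComplex (linePt a y)) *
    Quaternion.ofComplex (lineExp c a r y)

theorem lineTransform_one {c : ℝ} (hc : 0 < c) (a r : ℝ) :
    lineTransform c (fun _ => 1) a r = (gaussKer c 0 r : ℍ) := by
  have h2 := (Quaternion.ofComplex.toLinearMap.toContinuousLinearMap).integral_comp_comm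
    (integrable_pow_mul_lineExp hc 0 a r)
  have h4 : (2 * Real.pi : ℂ)⁻¹ * lineInt c 0 a r = (2 * Real.pi)⁻¹ • lineInt c 0 a r := by
    rw [Complex.real_smul]; push_cast; rfl
  rw [← ofComplex_ofReal, ofReal_gaussKer hc 0 a, h4, map_smul, lineTransform]
  congr 1
  simpa [lineInt] using h2

theorem norm_mul_lineExp_le {c a r y M : ℝ} {q : ℍ} (hq : ‖q‖ ≤ M) :
    ‖q * Quaternion.ofComplex (lineExp c a r y)‖ ≤ M * (lineWeight c 0 a y * Real.exp (a * r)) := by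
  rw [norm_mul, norm_ofComplex, norm_lineExp, lineWeight, pow_zero, one_mul]
  gcongr

theorem norm_lineTransform_le {c : ℝ} (hc : 0 < c) {F : ℍ → ℍ} {a M : ℝ}
    (hF : ∀ y, ‖F (Quaternion.ofComplex (linePt a y))‖ ≤ M) (r : ℝ) :
    ‖lineTransform c F a r‖ ≤
      ((2 * Real.pi)⁻¹ * (M * ∫ y, lineWeight c 0 a y)) * Real.exp (a * r) := by
  rw [lineTransform, norm_smul, Real.norm_of_nonneg (by positivity), mul_assoc, mul_assoc,
    ← integral_mul_const, ← integral_const_mul]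
  gcongr
  exact norm_integral_le_of_norm_le (((integrable_lineWeight hc 0 a).mul_const _).const_mul M)
    (Eventually.of_forall fun y => norm_mul_lineExp_le (hF y))

theorem tendsto_lineTransform {c : ℝ} (hc : 0 < c) {F : ℕ → ℍ → ℍ} {a M r : ℝ}
    (hm : ∀ n, AEStronglyMeasurable (fun y => F n (Quaternion.ofComplex (linePt a y)) *
      Quaternion.ofComplex (lineExp c a r y)) volume)
    (hF : ∀ n y, ‖F n (Quaternion.ofComplex (linePt a y))‖ ≤ M)
    (hlim : ∀ y, Tendsto (fun n => F n (Quaternion.ofComplex (linePt a y))) atTop (𝓝 1)) :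
    Tendsto (fun n => lineTransform c (F n) a r) atTop (𝓝 (gaussKer c 0 r : ℍ)) := by
  rw [← lineTransform_one hc a]
  refine Tendsto.const_smul ?_ _
  exact tendsto_integral_of_dominated_convergence
    (fun y => M * (lineWeight c 0 a y * Real.exp (a * r))) hm
    (((integrable_lineWeight hc 0 a).mul_const _).const_mul M)
    (fun n => Eventually.of_forall fun y => norm_mul_lineExp_le (hF n y))
    (Eventually.of_forall fun y => (hlim y).mul_const _)

/-! ### Real densities and real polynomials -/

/-- With a real density the transform maps the complex slice to itself. This lets the polynomial,
which stands on the left of `f`, move to the right. -/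
theorem densFun_commute {κ : ℝ} {ν : Measure ℝ} {ρ : ℝ → ℝ}
    (h : IsExpDensity κ ν fun t => (ρ t : ℍ)) {z : ℂ} (hz : |z.re| ≤ κ) (w : ℂ) :
    Commute (densFun ν (fun t => (ρ t : ℍ)) (Quaternion.ofComplex z))
      (Quaternion.ofComplex w) := by
  have hi := integrable_density_mul_exp h (s := Quaternion.ofComplex z) (by rwa [ofComplex_re])
  rw [Commute, SemiconjBy, densFun, ← integral_mul_const_of_integrable hi,
    ← integral_const_mul_of_integrable hi]
  congr 1 with t : 1
  rw [exp_neg_smul_ofComplex, ← ofComplex_ofReal, ← map_mul, ← map_mul, ← map_mul, mul_comm]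

theorem eval_map_ofComplex (Q : Polynomial ℝ) (z : ℂ) :
    (Q.map (algebraMap ℝ ℍ)).eval (Quaternion.ofComplex z) =
      Quaternion.ofComplex (Polynomial.aeval z Q) := by
  rw [← Polynomial.aeval_algHom_apply, Polynomial.aeval_def, Polynomial.eval_map]

/-- Applying `Q(d/dr)` to the convolution multiplies its transform by `Q`. -/
theorem sum_heatConv_eq_lineTransform {κ c a : ℝ} {ν : Measure ℝ} {ρ : ℝ → ℝ}
    (h : IsExpDensity κ ν fun t => (ρ t : ℍ)) (hc : 0 < c) (ha : |a| ≤ κ) (Q : Polynomial ℝ)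
    (r : ℝ) :
    Integrable (fun y => (Q.map (algebraMap ℝ ℍ)).eval (Quaternion.ofComplex (linePt a y)) *
      densFun ν (fun t => (ρ t : ℍ)) (Quaternion.ofComplex (linePt a y)) *
        Quaternion.ofComplex (lineExp c a r y)) ∧
    ∑ k ∈ Finset.range (Q.natDegree + 1), Q.coeff k • heatConv c k ν (fun t => (ρ t : ℍ)) r =
      lineTransform c (fun s => (Q.map (algebraMap ℝ ℍ)).eval s *
        densFun ν (fun t => (ρ t : ℍ)) s) a r := by
  have key : ∀ y, (Q.map (algebraMap ℝ ℍ)).eval (Quaternion.ofComplex (linePt a y)) *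
      densFun ν (fun t => (ρ t : ℍ)) (Quaternion.ofComplex (linePt a y)) *
        Quaternion.ofComplex (lineExp c a r y) =
      ∑ k ∈ Finset.range (Q.natDegree + 1), Q.coeff k •
        (densFun ν (fun t => (ρ t : ℍ)) (Quaternion.ofComplex (linePt a y)) *
          Quaternion.ofComplex (linePt a y ^ k * lineExp c a r y)) := by
    intro y
    rw [eval_map_ofComplex, ← (densFun_commute h (by rwa [linePt_re]) _).eq, mul_assoc, ← map_mul,
      Polynomial.aeval_eq_sum_range, Finset.sum_mul, map_sum, Finset.mul_sum]
    refine Finset.sum_congr rfl fun k _ => ?_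
    rw [smul_mul_assoc, map_smul, mul_smul_comm]
  have hi : ∀ k, Integrable fun y => Q.coeff k •
      (densFun ν (fun t => (ρ t : ℍ)) (Quaternion.ofComplex (linePt a y)) *
        Quaternion.ofComplex (linePt a y ^ k * lineExp c a r y)) := fun k =>
    Integrable.smul (Q.coeff k) (integrable_densFun_line h hc ha k r)
  simp_rw [lineTransform, key]
  refine ⟨integrable_finsetSum _ fun k _ => hi k, ?_⟩
  rw [integral_finsetSum _ fun k _ => hi k, Finset.smul_sum]
  refine Finset.sum_congr rfl fun k _ => ?_
  rw [heatConv_eq_line h hc ha, integral_smul, smul_comm]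

/-! ### The functional calculus composed with smoothing operators -/

section

variable {V : Type*} [NormedAddCommGroup V] [NormedSpace ℝ V] [CompleteSpace V]
  [Module ℍ V] [Module ℍᵐᵒᵖ V] [NormSMulClass ℍ V] [IsScalarTower ℝ ℍ V]
  {U : StronglyContGroup V} {ω K ε c : ℝ} {ν : Measure ℝ} {θ : ℝ → ℍ}

omit [NormedSpace ℝ V] [CompleteSpace V] [IsScalarTower ℝ ℍ V] in
theorem norm_density_smul_le (h : IsExpDensity (ω + ε) ν θ) (hε : 0 ≤ ε)
    (hU : ∀ t v, ‖U t v‖ ≤ K * Real.exp (ω * |t|) * ‖v‖) (v : V) (t : ℝ) :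
    ‖θ t • U (-t) v‖ ≤ |K| * ‖v‖ * Real.exp ((ω + ε) * |t|) := by
  rw [norm_smul]
  calc ‖θ t‖ * ‖U (-t) v‖ ≤ 1 * (|K| * Real.exp ((ω + ε) * |t|) * ‖v‖) := by
        refine mul_le_mul (h.norm_le t) ((hU (-t) v).trans ?_) (norm_nonneg _) zero_le_one
        rw [abs_neg]
        gcongr
        · exact le_abs_self K
        · linarith
    _ = _ := by ring

omit [NormedSpace ℝ V] [CompleteSpace V] [IsScalarTower ℝ ℍ V] in
theorem integrable_density_smul (h : IsExpDensity (ω + ε) ν θ) (hε : 0 ≤ ε)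
    (hU : ∀ t v, ‖U t v‖ ≤ K * Real.exp (ω * |t|) * ‖v‖) (v : V) :
    Integrable (fun t => θ t • U (-t) v) ν :=
  (h.moment.const_mul (|K| * ‖v‖)).mono' (h.measurable.aestronglyMeasurable.smul
    ((U.continuous_orbit v).comp continuous_neg).aestronglyMeasurable)
    (Eventually.of_forall (norm_density_smul_le h hε hU v))

omit [CompleteSpace V] in
/-- The bounded operator `v ↦ ∫ θ(t) U(-t) v dν(t)`. -/
theorem exists_densOp_clm (h : IsExpDensity (ω + ε) ν θ) (hε : 0 ≤ ε)
    (hU : ∀ t v, ‖U t v‖ ≤ K * Real.exp (ω * |t|) * ‖v‖) :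
    ∃ R : V →L[ℝ] V, ∀ v, R v = densOp U ν θ v := by
  let R₀ : V →ₗ[ℝ] V :=
    { toFun := densOp U ν θ
      map_add' := fun v w => by
        rw [densOp, densOp, densOp, ← integral_add (integrable_density_smul h hε hU v)
          (integrable_density_smul h hε hU w)]
        simp
      map_smul' := fun r v => by
        rw [RingHom.id_apply, densOp, densOp, ← integral_smul]
        simp_rw [group_smul, smul_comm r] }
  refine ⟨R₀.mkContinuous (|K| * ∫ t, Real.exp ((ω + ε) * |t|) ∂ν) fun v => ?_, fun v => rfl⟩
  calc ‖densOp U ν θ v‖ ≤ ∫ t, |K| * ‖v‖ * Real.exp ((ω + ε) * |t|) ∂ν :=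
        norm_integral_le_of_norm_le (h.moment.const_mul _)
          (Eventually.of_forall (norm_density_smul_le h hε hU v))
    _ = _ := by rw [integral_const_mul]; ring

omit [CompleteSpace V] [NormSMulClass ℍ V] in
theorem smul_group_coe {s : ℝ} (r : ℝ) (U : StronglyContGroup V) (v : V) :
    U s ((r : ℍ) • v) = (r : ℍ) • U s v := by
  have h : ∀ x : V, (r : ℍ) • x = r • x := fun x => algebraMap_smul ℍ r x
  rw [h, h, group_smul]

/-- `∫ ρ(t) U(-t) dν(t)` commutes with the group when `ρ` is real. -/
theorem group_densOp_comm {ρ : ℝ → ℝ} (h : IsExpDensity (ω + ε) ν fun t => (ρ t : ℍ)) (hε : 0 ≤ ε)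
    (hU : ∀ t v, ‖U t v‖ ≤ K * Real.exp (ω * |t|) * ‖v‖) (s : ℝ) (v : V) :
    U s (densOp U ν (fun t => (ρ t : ℍ)) v) = densOp U ν (fun t => (ρ t : ℍ)) (U s v) := by
  rw [densOp, densOp, group_integral U s (integrable_density_smul h hε hU v)]
  congr 1 with t
  rw [smul_group_coe, ← group_add_apply, ← group_add_apply, add_comm]

omit [NormedSpace ℝ V] [CompleteSpace V] [IsScalarTower ℝ ℍ V] in
theorem integrable_prod_smoothing (h : IsExpDensity (ω + ε) ν θ) (hω : 0 ≤ ω) (hε : 0 < ε)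
    (hU : ∀ t v, ‖U t v‖ ≤ K * Real.exp (ω * |t|) * ‖v‖) (hc : 0 < c) (k : ℕ) (u : V) :
    Integrable (fun p : ℝ × ℝ => (gaussKer c k (p.2 - p.1) • θ p.1) • U (-p.2) u)
      (ν.prod volume) := by
  have := h.finite
  obtain ⟨C, hC0, hC⟩ := exists_abs_gaussKer_le hc k (ω + ε)
  have hb := h.moment.mul_prod ((integrable_exp_neg_mul_abs hε).const_mul (C * |K| * ‖u‖))
  refine hb.mono' ?_ (Eventually.of_forall fun p => ?_)
  · have h1 : AEStronglyMeasurable (fun p : ℝ × ℝ => gaussKer c k (p.2 - p.1))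
        (ν.prod volume) :=
      ((continuous_gaussKer hc k).comp (by fun_prop)).aestronglyMeasurable
    have h2 : AEStronglyMeasurable (fun p : ℝ × ℝ => U (-p.2) u) (ν.prod volume) :=
      ((U.continuous_orbit u).comp (by fun_prop)).aestronglyMeasurable
    exact (h1.smul (h.measurable.comp_measurable measurable_fst).aestronglyMeasurable).smul h2
  · rw [norm_smul, norm_smul, Real.norm_eq_abs]
    -- The triangle inequality separates the variables: the moment of `ν` absorbs the first factor,
    -- and the second leaves `e^{-ε|r|}` against the growth of the group.
    have h1 : Real.exp (-((ω + ε) * |p.2 - p.1|)) ≤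
        Real.exp ((ω + ε) * |p.1|) * Real.exp (-((ω + ε) * |p.2|)) := by
      rw [← Real.exp_add, Real.exp_le_exp]
      have h2 : |p.2| ≤ |p.2 - p.1| + |p.1| := by
        simpa using abs_add_le (p.2 - p.1) p.1
      nlinarith
    have h3 : ‖U (-p.2) u‖ ≤ |K| * Real.exp (ω * |p.2|) * ‖u‖ := (hU _ u).trans (by
      rw [abs_neg]; gcongr; exact le_abs_self K)
    calc |gaussKer c k (p.2 - p.1)| * ‖θ p.1‖ * ‖U (-p.2) u‖
        ≤ (C * (Real.exp ((ω + ε) * |p.1|) * Real.exp (-((ω + ε) * |p.2|)))) * 1 *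
            (|K| * Real.exp (ω * |p.2|) * ‖u‖) := by
          refine mul_le_mul (mul_le_mul ((hC _).trans ?_) (h.norm_le _) (norm_nonneg _)
            (by positivity)) h3 (norm_nonneg _) (by positivity)
          gcongr
      _ = Real.exp ((ω + ε) * |p.1|) * (C * |K| * ‖u‖ *
            (Real.exp (-((ω + ε) * |p.2|)) * Real.exp (ω * |p.2|))) := by ring
      _ = _ := by rw [← Real.exp_add]; ring_nf

theorem integral_heatConv_inner (h : IsExpDensity (ω + ε) ν θ) (hc : 0 < c) (k : ℕ) (u : V)
    (r : ℝ) : ∫ t, (gaussKer c k (r - t) • θ t) • U (-r) u ∂ν =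
      heatConv c k ν θ r • U (-r) u := by
  obtain ⟨C, -, hC⟩ := exists_abs_gaussKer_le hc k 0
  have hi : Integrable (fun t => gaussKer c k (r - t) • θ t) ν :=
    h.integrable.bdd_smul (φ := fun t => gaussKer c k (r - t)) C
      ((continuous_gaussKer hc k).comp (by fun_prop)).aestronglyMeasurable
      (Eventually.of_forall fun t => by simpa using hC (r - t))
  exact (smulPairing V (U (-r) u)).integral_comp_comm hi

theorem integrable_heatConv_smul (h : IsExpDensity (ω + ε) ν θ) (hω : 0 ≤ ω) (hε : 0 < ε)
    (hU : ∀ t v, ‖U t v‖ ≤ K * Real.exp (ω * |t|) * ‖v‖) (hc : 0 < c) (k : ℕ) (u : V) :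
    Integrable fun r => heatConv c k ν θ r • U (-r) u := by
  have := h.finite
  exact (integrable_prod_smoothing h hω hε hU hc k u).integral_prod_right.congr
    (Eventually.of_forall fun r => integral_heatConv_inner h hc k u r)

/-- On smoothed vectors the operator depends on the measure only through its convolution with the
kernel, hence only on values of the transform. -/
theorem densOp_smoothing (h : IsExpDensity (ω + ε) ν θ) (hω : 0 ≤ ω) (hε : 0 < ε)
    (hU : ∀ t v, ‖U t v‖ ≤ K * Real.exp (ω * |t|) * ‖v‖) (hc : 0 < c) (k : ℕ) (u : V) :
    densOp U ν θ (smoothing U c k u) = ∫ r, heatConv c k ν θ r • U (-r) u := by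
  have := h.finite
  simp_rw [← integral_heatConv_inner h hc k u]
  rw [← integral_integral_swap (integrable_prod_smoothing h hω hε hU hc k u), densOp]
  congr 1 with t
  rw [group_smoothing hU hc, ← integral_smul]
  congr 1 with r
  rw [smul_comm, smul_assoc, ← sub_eq_add_neg]

/-- If `F` is a polynomial multiple of the transform of a real density, and the transform of another
density, then the operators of the two functions agree on smoothed vectors; they are given by the
inverse transform along any line in the strip. -/
theorem densOp_smoothing_eq {ε' : ℝ} {ν' : Measure ℝ} {θ' : ℝ → ℍ} {ρ : ℝ → ℝ} {f : ℍ → ℍ}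
    (h : IsExpDensity (ω + ε) ν fun t => (ρ t : ℍ)) (h' : IsExpDensity (ω + ε') ν' θ')
    (hω : 0 ≤ ω) (hε : 0 < ε) (hε' : 0 < ε')
    (hU : ∀ t v, ‖U t v‖ ≤ K * Real.exp (ω * |t|) * ‖v‖) (hc : 0 < c) (Q : Polynomial ℝ)
    (hf : ∀ s : ℍ, |s.re| < ω + ε → f s = densFun ν (fun t => (ρ t : ℍ)) s)
    (hQ : ∀ s : ℍ, |s.re| < ω + ε' → (Q.map (algebraMap ℝ ℍ)).eval s * f s = densFun ν' θ' s)
    (u : V) :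
    (Integrable fun r => heatConv c 0 ν' θ' r • U (-r) u) ∧
    (∀ a, |a| < ω + ε → ∀ r, heatConv c 0 ν' θ' r =
      lineTransform c (fun s => (Q.map (algebraMap ℝ ℍ)).eval s * f s) a r) ∧
    densOp U ν' θ' (smoothing U c 0 u) = ∑ k ∈ Finset.range (Q.natDegree + 1),
      Q.coeff k • densOp U ν (fun t => (ρ t : ℍ)) (smoothing U c k u) := by
  have hline : ∀ a, |a| < ω + ε → ∀ r,
      ∑ k ∈ Finset.range (Q.natDegree + 1), Q.coeff k • heatConv c k ν (fun t => (ρ t : ℍ)) r =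
        lineTransform c (fun s => (Q.map (algebraMap ℝ ℍ)).eval s * f s) a r := by
    intro a ha r
    rw [(sum_heatConv_eq_lineTransform h hc ha.le Q r).2, lineTransform, lineTransform]
    congr 2 with y : 1
    rw [hf _ (by rwa [ofComplex_re, linePt_re])]
  -- The line `Re z = 0` lies in both strips. Once the convolutions are identified there, `hline`
  -- gives all lines in the strip of `f`, however small `ε'` is.
  have h0 : ∀ r, heatConv c 0 ν' θ' r =
      lineTransform c (fun s => (Q.map (algebraMap ℝ ℍ)).eval s * f s) 0 r := by
    intro r
    rw [heatConv_eq_line h' hc (a := 0) (by rw [abs_zero]; linarith), lineTransform]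
    congr 2 with y : 1
    rw [hQ _ (by rw [ofComplex_re, linePt_re, abs_zero]; linarith), pow_zero, one_mul]
  have h1 : ∀ r, heatConv c 0 ν' θ' r =
      ∑ k ∈ Finset.range (Q.natDegree + 1), Q.coeff k • heatConv c k ν (fun t => (ρ t : ℍ)) r :=
    fun r => (h0 r).trans (hline 0 (by rw [abs_zero]; linarith) r).symm
  refine ⟨integrable_heatConv_smul h' hω hε' hU hc 0 u,
    fun a ha r => (h1 r).trans (hline a ha r), ?_⟩
  rw [densOp_smoothing h' hω hε' hU hc]
  simp_rw [h1, Finset.sum_smul, smul_assoc, densOp_smoothing h hω hε hU hc]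
  have hi : ∀ k, Integrable fun r =>
      Q.coeff k • heatConv c k ν (fun t => (ρ t : ℍ)) r • U (-r) u := fun k =>
    Integrable.smul (Q.coeff k) (integrable_heatConv_smul h hω hε hU hc k u)
  rw [integral_finsetSum _ fun k _ => hi k]
  simp_rw [integral_smul]

end

/-! ### Real measures of intrinsic functions and convergence on smoothed vectors -/

section

variable {V : Type*} [NormedAddCommGroup V] [NormedSpace ℝ V] [CompleteSpace V]
  [Module ℍ V] [Module ℍᵐᵒᵖ V] [NormSMulClass ℍ V] [IsScalarTower ℝ ℍ V]
  {U : StronglyContGroup V} {ω K : ℝ}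

/-- An intrinsic element of the class `𝐕(T)` is the transform of a real measure. -/
theorem exists_real_isExpDensity (hω : 0 ≤ ω)
    (hU : ∀ t v, ‖U t v‖ ≤ K * Real.exp (ω * |t|) * ‖v‖) {f : ℍ → ℍ} (hf : f ∈ classV ω)
    (hfi : ∃ δ > 0, IsIntrinsicOn {s : ℍ | |s.re| < ω + δ} f) :
    ∃ ε > 0, ∃ (ν : Measure ℝ) (ρ : ℝ → ℝ), IsExpDensity (ω + ε) ν (fun t => (ρ t : ℍ)) ∧
      (∀ s : ℍ, |s.re| < ω + ε → f s = densFun ν (fun t => (ρ t : ℍ)) s) ∧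
      ∀ v, funCalc U ω f v = densOp U ν (fun t => (ρ t : ℍ)) v := by
  obtain ⟨ε, hε, ν, θ, h, hfs, hfc⟩ := exists_isExpDensity U hω hU hf
  obtain ⟨δ, hδ, hfδ⟩ := hfi
  have hre : ∀ᵐ t ∂ν, θ t = ((θ t).re : ℍ) := by
    refine h.ae_eq_re (δ := ω + min ε δ) (by positivity) fun s hs => ?_
    have h1 : |s.re| < ω + ε := lt_of_lt_of_le hs (by gcongr; exact min_le_left _ _)
    have h2 : |s.re| < ω + δ := lt_of_lt_of_le hs (by gcongr; exact min_le_right _ _)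
    rw [← hfs s h1, ← hfs (star s) (by rwa [Quaternion.re_star]), hfδ s h2]
  refine ⟨ε, hε, ν, fun t => (θ t).re, ⟨h.finite, ?_, fun t => ?_, h.moment⟩, fun s hs => ?_,
    fun v => ?_⟩
  · exact (Quaternion.continuous_coe.comp Quaternion.continuous_re).comp_stronglyMeasurable
      h.measurable
  · rw [Quaternion.norm_coe]
    refine le_trans ?_ (h.norm_le t)
    rw [← sq_le_sq₀ (norm_nonneg _) (norm_nonneg _), Real.norm_eq_abs, sq_abs, pow_two ‖θ t‖,
      ← Quaternion.normSq_eq_norm_mul_self, Quaternion.normSq_def']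
    nlinarith [sq_nonneg (θ t).imI, sq_nonneg (θ t).imJ, sq_nonneg (θ t).imK]
  · rw [hfs s hs]
    exact integral_congr_ae (by filter_upwards [hre] with t ht; rw [← ht])
  · rw [hfc v]
    exact integral_congr_ae (by filter_upwards [hre] with t ht; rw [← ht])

/-- On smoothed vectors the operators `(Pₙ f)(T)` of an inverting sequence converge to the
identity. -/
theorem tendsto_funCalc_smoothing (hω : 0 ≤ ω)
    (hU : ∀ t v, ‖U t v‖ ≤ K * Real.exp (ω * |t|) * ‖v‖) {f : ℍ → ℍ} {ε : ℝ} (hε : 0 < ε)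
    {ν : Measure ℝ} {ρ : ℝ → ℝ} (h : IsExpDensity (ω + ε) ν fun t => (ρ t : ℍ))
    (hf : ∀ s : ℍ, |s.re| < ω + ε → f s = densFun ν (fun t => (ρ t : ℍ)) s)
    {P : ℕ → Polynomial ℍ} (hP : IsInvertingSequence U ω f P) {c : ℝ} (hc : 0 < c) (u : V) :
    Tendsto (fun n => funCalc U ω (fun s => (P n).eval s * f s) (smoothing U c 0 u)) atTop
      (𝓝 (smoothing U c 0 u)) := by
  obtain ⟨ε₁, hε₁, M, hM, hstrip⟩ := hP.strip
  choose Q hQ using fun n => (hP.intrinsic n).exists_real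
  choose ε' hε' ν' θ' h' hF hcalc using fun n => exists_isExpDensity U hω hU (hP.mem n)
  have hmain := fun n => densOp_smoothing_eq h (h' n) hω hε (hε' n) hU hc (Q n) hf
    (fun s hs => by rw [← hQ n, ← hF n s hs]) u
  simp_rw [hcalc, densOp_smoothing (h' _) hω (hε' _) hU hc]
  -- `A` exceeds `ω`, lies strictly inside the strip of `f`, and stays within the strip where `Pₙ f`
  -- is bounded.
  set A := ω + min (ε / 2) ε₁ with hA
  have hm0 : 0 < min (ε / 2) ε₁ := lt_min (by positivity) hε₁
  have hA1 : A < ω + ε := by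
    have := min_le_left (ε / 2) ε₁
    linarith
  have hA2 : A ≤ ω + ε₁ := by
    have := min_le_right (ε / 2) ε₁
    linarith
  have hAω : ω < A := by linarith
  have hA0 : 0 < A := by linarith
  -- The strips of the measures of `Pₙ f` may shrink with `n`; the strip of `f` supplies lines that
  -- serve every `n`.
  have hline : ∀ a, |a| ≤ A → ∀ n r, heatConv c 0 (ν' n) (θ' n) r =
      lineTransform c (fun s => (P n).eval s * f s) a r := by
    intro a ha n r
    rw [(hmain n).2.1 a (ha.trans_lt hA1) r, hQ n]
  have hre : ∀ a y, |a| ≤ A → |(Quaternion.ofComplex (linePt a y)).re| ≤ ω + ε₁ := by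
    intro a y ha
    rw [ofComplex_re, linePt_re]
    exact ha.trans hA2
  have hbound : ∀ a, |a| ≤ A → ∀ n r, ‖heatConv c 0 (ν' n) (θ' n) r‖ ≤
      ((2 * Real.pi)⁻¹ * (M * ∫ y, lineWeight c 0 a y)) * Real.exp (a * r) := by
    intro a ha n r
    rw [hline a ha]
    exact norm_lineTransform_le hc (F := fun s => (P n).eval s * f s) (fun y => (hstrip _ (hre a y ha)).1 n) r
  have hlim : ∀ r, Tendsto (fun n => heatConv c 0 (ν' n) (θ' n) r) atTop
      (𝓝 (gaussKer c 0 r : ℍ)) := by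
    intro r
    simp_rw [hline 0 (by rw [abs_zero]; exact hA0.le)]
    refine tendsto_lineTransform hc (F := fun n s => (P n).eval s * f s) (fun n => ?_)
      (fun n y => (hstrip _ (hre 0 y (by rw [abs_zero]; exact hA0.le))).1 n)
      (fun y => (hstrip _ (hre 0 y (by rw [abs_zero]; exact hA0.le))).2)
    refine (sum_heatConv_eq_lineTransform h hc (a := 0) (by rw [abs_zero]; linarith) (Q n)
      r).1.aestronglyMeasurable.congr (Eventually.of_forall fun y => ?_)
    simp only
    rw [hQ n, hf _ (by rw [ofComplex_re, linePt_re, abs_zero]; linarith)]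
  have hs : smoothing U c 0 u = ∫ r, (gaussKer c 0 r : ℍ) • U (-r) u := by
    rw [smoothing]
    congr 1 with r
    exact (algebraMap_smul ℍ (gaussKer c 0 r) (U (-r) u)).symm
  rw [hs]
  set D := max ((2 * Real.pi)⁻¹ * (M * ∫ y, lineWeight c 0 A y))
    ((2 * Real.pi)⁻¹ * (M * ∫ y, lineWeight c 0 (-A) y)) with hD
  have hb : ∀ n r, ‖heatConv c 0 (ν' n) (θ' n) r‖ ≤ D * Real.exp (-(A * |r|)) := fun n r =>
    le_max_mul_exp_neg_abs (hbound A (abs_of_pos hA0).le n r)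
      (hbound (-A) (by rw [abs_neg, abs_of_pos hA0]) n r)
  refine tendsto_integral_of_dominated_convergence
    (fun r => D * K * ‖u‖ * Real.exp (-((A - ω) * |r|))) (fun n => (hmain n).1.aestronglyMeasurable)
    ((integrable_exp_neg_mul_abs (sub_pos.2 hAω)).const_mul _)
    (fun n => Eventually.of_forall fun r => ?_)
    (Eventually.of_forall fun r => (hlim r).smul_const _)
  rw [norm_smul]
  calc ‖heatConv c 0 (ν' n) (θ' n) r‖ * ‖U (-r) u‖
      ≤ (D * Real.exp (-(A * |r|))) * (K * Real.exp (ω * |-r|) * ‖u‖) :=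
        mul_le_mul (hb n r) (hU _ _) (norm_nonneg _) ((norm_nonneg _).trans (hb n r))
    _ = D * K * ‖u‖ * (Real.exp (-(A * |r|)) * Real.exp (ω * |r|)) := by rw [abs_neg]; ring
    _ = _ := by rw [← Real.exp_add]; ring_nf

end

/-! ### Polynomials of the generator -/

/-- If `p[A] x_j` and `x_j` converge, and `A` has a bounded resolvent, then `Aᵏ x_j` converges for
all `k ≤ deg p`; here `x k j` stands for `Aᵏ x_j`. -/
theorem exists_tendsto_of_polynomial {V : Type*} [NormedAddCommGroup V] [NormedSpace ℝ V]
    (R : V →L[ℝ] V) (lam : ℝ) (x : ℕ → ℕ → V)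
    (hx : ∀ k j, R (lam • x k j - x (k + 1) j) = x k j) (h0 : ∃ l, Tendsto (x 0) atTop (𝓝 l))
    (p : Polynomial ℝ)
    (hp : ∃ l, Tendsto (fun j => ∑ k ∈ Finset.range (p.natDegree + 1), p.coeff k • x k j)
      atTop (𝓝 l)) :
    ∀ k ≤ p.natDegree, ∃ l, Tendsto (x k) atTop (𝓝 l) := by
  let Φ : ℕ → Polynomial ℝ →ₗ[ℝ] V := fun j =>
    Polynomial.lsum fun k => LinearMap.toSpanSingleton ℝ V (x k j)
  have hΦ : ∀ j (p : Polynomial ℝ), Φ j p =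
      ∑ k ∈ Finset.range (p.natDegree + 1), p.coeff k • x k j := fun j p =>
    Polynomial.sum_over_range p (fun k => zero_smul ℝ (x k j))
  have hmon : ∀ j k a, Φ j (Polynomial.monomial k a) = a • x k j := fun j k a =>
    Polynomial.sum_monomial_index a _ (zero_smul ℝ (x k j))
  -- `Φ j p` plays the role of `p[A] x_j`, and `R` that of the inverse of `lam - A`, which accounts
  -- for the sign.
  have hR : ∀ j p, R (Φ j ((Polynomial.X - Polynomial.C lam) * p)) = -Φ j p := by
    intro j p
    induction p using Polynomial.induction_on' with
    | add p q hp hq => rw [mul_add, map_add, map_add, hp, hq, map_add, neg_add]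
    | monomial k a =>
      have h1 : lam • x k j - x (k + 1) j = -(x (k + 1) j - lam • x k j) := by abel
      have h2 := hx k j
      rw [h1, map_neg, neg_eq_iff_eq_neg] at h2
      rw [sub_mul, Polynomial.X_mul_monomial, Polynomial.C_mul_monomial, map_sub, hmon, hmon, hmon,
        mul_comm lam, mul_smul, ← smul_sub, map_smul, h2, smul_neg]
  obtain ⟨m, hm⟩ : ∃ m, p.natDegree = m := ⟨_, rfl⟩
  simp_rw [← hΦ] at hp
  induction m generalizing p with
  | zero =>
    intro k hk
    obtain rfl : k = 0 := by omega
    exact h0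
  | succ m ih =>
    set q := p /ₘ (Polynomial.X - Polynomial.C lam) with hq
    have hpq : p = Polynomial.C (p.eval lam) + (Polynomial.X - Polynomial.C lam) * q := by
      rw [← Polynomial.modByMonic_X_sub_C_eq_C_eval, hq, Polynomial.modByMonic_add_div]
    have hqd : q.natDegree = m := by
      rw [hq, Polynomial.natDegree_divByMonic _ (Polynomial.monic_X_sub_C lam),
        Polynomial.natDegree_X_sub_C, hm, Nat.add_sub_cancel]
    obtain ⟨l, hl⟩ := hp
    obtain ⟨l0, hl0⟩ := h0
    -- Writing `p = p(lam) + (X - lam) q` and applying `R` expresses `q[A] x_j` through convergent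
    -- sequences; induct on the degree.
    have hqlim : Tendsto (fun j => Φ j q) atTop (𝓝 (p.eval lam • R l0 - R l)) := by
      have h1 : ∀ j, Φ j q = p.eval lam • R (x 0 j) - R (Φ j p) := by
        intro j
        have h2 : Φ j p = p.eval lam • x 0 j + Φ j ((Polynomial.X - Polynomial.C lam) * q) := by
          conv_lhs => rw [hpq]
          rw [map_add, ← Polynomial.monomial_zero_left, hmon]
        rw [h2, map_add, map_smul, hR]
        abel
      simp_rw [h1]
      exact (((R.continuous.tendsto _).comp hl0).const_smul _).sub
        ((R.continuous.tendsto _).comp hl)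
    have hlow := ih q hqd ⟨_, hqlim⟩
    rw [hqd] at hlow
    intro k hk
    rw [hm] at hk
    rcases Nat.lt_or_ge m k with hmk | hmk
    · obtain rfl : k = m + 1 := by omega
      -- The top power is recovered from `p[A] x_j` and the lower powers by dividing by the leading
      -- coefficient.
      have hlead : p.coeff (m + 1) ≠ 0 := by
        rw [← hm, Polynomial.coeff_natDegree, Polynomial.leadingCoeff_ne_zero]
        rintro rfl
        simp at hm
      choose! L hL using hlow
      refine ⟨(p.coeff (m + 1))⁻¹ • (l - ∑ k ∈ Finset.range (m + 1), p.coeff k • L k),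
        ((hl.sub (tendsto_finsetSum _ fun k hk => (hL k (by
          simp only [Finset.mem_range] at hk; omega)).const_smul (p.coeff k))).const_smul _).congr
            fun j => ?_⟩
      rw [hΦ, hm, Finset.sum_range_succ, add_sub_cancel_left, inv_smul_smul₀ hlead]
    · exact hlow k hmk

section PartialMaps

variable {V : Type*} [NormedAddCommGroup V] [Module ℍᵐᵒᵖ V]

/-- Membership and value are bundled so that both propagate together through powers and sums. -/
theorem pcomp_apply_eq [NormedSpace ℝ V] [Module ℍ V] {A B : V →ₗ.[ℍᵐᵒᵖ] V} {v y z : V}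
    (hB : ∃ h : v ∈ B.domain, B ⟨v, h⟩ = y) (hA : ∃ h : y ∈ A.domain, A ⟨y, h⟩ = z) :
    ∃ h : v ∈ (pcomp A B).domain, pcomp A B ⟨v, h⟩ = z := by
  obtain ⟨hv, rfl⟩ := hB
  obtain ⟨hy, rfl⟩ := hA
  exact ⟨⟨⟨⟨v, hv⟩, hy, rfl⟩, hv⟩, rfl⟩

theorem sum_pmap_apply_eq {ι : Type*} {A : ι → V →ₗ.[ℍᵐᵒᵖ] V} {s : Finset ι} {v : V} {w : ι → V}
    (h : ∀ k ∈ s, ∃ h : v ∈ (A k).domain, A k ⟨v, h⟩ = w k) :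
    ∃ h : v ∈ (∑ k ∈ s, A k).domain, (∑ k ∈ s, A k) ⟨v, h⟩ = ∑ k ∈ s, w k := by
  classical
  induction s using Finset.induction_on with
  | empty => exact ⟨trivial, rfl⟩
  | insert a s ha ih =>
    obtain ⟨h1, h2⟩ := ih fun k hk => h k (Finset.mem_insert_of_mem hk)
    obtain ⟨h3, h4⟩ := h a (Finset.mem_insert_self a s)
    rw [Finset.sum_insert ha, Finset.sum_insert ha]
    refine ⟨⟨h3, h1⟩, ?_⟩
    rw [← h2, ← h4]
    rfl

variable [NormedSpace ℝ V] [Module ℍ V] [NormSMulClass ℍᵐᵒᵖ V] [SMulCommClass ℝ ℍᵐᵒᵖ V]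

theorem ppow_generator_apply_eq {U : StronglyContGroup V} {w : ℕ → V} {m : ℕ}
    (h : ∀ k < m, IsGen U (w k) (w (k + 1))) {k : ℕ} (hk : k ≤ m) :
    ∃ h : w 0 ∈ (ppow (generator U) k).domain, ppow (generator U) k ⟨w 0, h⟩ = w k := by
  induction k with
  | zero => exact ⟨trivial, rfl⟩
  | succ k ih =>
    have hg := h k hk
    exact pcomp_apply_eq (ih (by omega)) ⟨hg.mem_domain, hg.generator_eq _⟩

theorem polyOp_generator_apply_eq [SMulCommClass ℍᵐᵒᵖ ℍ V] [IsScalarTower ℝ ℍ V]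
    {U : StronglyContGroup V} {w : ℕ → V} (p : Polynomial ℝ)
    (h : ∀ k < p.natDegree, IsGen U (w k) (w (k + 1))) :
    ∃ h : w 0 ∈ (polyOp (p.map (algebraMap ℝ ℍ)) (generator U)).domain,
      polyOp (p.map (algebraMap ℝ ℍ)) (generator U) ⟨w 0, h⟩ =
        ∑ k ∈ Finset.range (p.natDegree + 1), p.coeff k • w k := by
  have hd : (p.map (algebraMap ℝ ℍ)).natDegree = p.natDegree :=
    Polynomial.natDegree_map_eq_of_injective (algebraMap ℝ ℍ).injective p
  unfold polyOp
  rw [hd]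
  refine sum_pmap_apply_eq fun k hk => ?_
  obtain ⟨h1, h2⟩ := ppow_generator_apply_eq h (k := k) (by
    simp only [Finset.mem_range] at hk; omega)
  refine ⟨h1, ?_⟩
  rw [LinearPMap.smul_apply, h2, Polynomial.coeff_map, algebraMap_smul]

end PartialMaps

/-! ### The product rule relating `(P f)(T)` and `P[T] f(T)` -/

section

variable {V : Type*} [NormedAddCommGroup V] [NormedSpace ℝ V] [CompleteSpace V]
  [Module ℍ V] [Module ℍᵐᵒᵖ V] [SMulCommClass ℍᵐᵒᵖ ℍ V]
  [NormSMulClass ℍ V] [NormSMulClass ℍᵐᵒᵖ V]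
  [IsScalarTower ℝ ℍ V] [SMulCommClass ℝ ℍᵐᵒᵖ V]
  {U : StronglyContGroup V} {ω K : ℝ}

/-- `(P f)(T) = P[T] f(T)` for an intrinsic polynomial `P` with `P f ∈ 𝐕(T)`. -/
theorem polyOp_funCalc_eq (hω : 0 ≤ ω)
    (hU : ∀ t v, ‖U t v‖ ≤ K * Real.exp (ω * |t|) * ‖v‖) {f : ℍ → ℍ} {ε : ℝ} (hε : 0 < ε)
    {ν : Measure ℝ} {ρ : ℝ → ℝ} (h : IsExpDensity (ω + ε) ν fun t => (ρ t : ℍ))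
    (hf : ∀ s : ℍ, |s.re| < ω + ε → f s = densFun ν (fun t => (ρ t : ℍ)) s)
    {P : Polynomial ℍ} (hP : IsIntrinsicPoly P) (hPf : (fun s => P.eval s * f s) ∈ classV ω)
    (u : V) :
    ∃ hd : densOp U ν (fun t => (ρ t : ℍ)) u ∈ (polyOp P (generator U)).domain,
      polyOp P (generator U) ⟨densOp U ν (fun t => (ρ t : ℍ)) u, hd⟩ =
        funCalc U ω (fun s => P.eval s * f s) u := by
  obtain ⟨Q, rfl⟩ := hP.exists_real
  obtain ⟨ε', hε', ν', θ', h', hF, hcalc⟩ := exists_isExpDensity U hω hU hPf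
  obtain ⟨B, hB⟩ := exists_densOp_clm h hε.le hU
  obtain ⟨B', hB'⟩ := exists_densOp_clm h' hε'.le hU
  obtain ⟨c, hc, hclim⟩ := exists_smoothing_tendsto hU
  obtain ⟨R, hR, -⟩ := exists_resolvent hU
  rw [hcalc, ← hB', ← hB]
  have hcomm : ∀ t v, U t (B v) = B (U t v) := fun t v => by
    rw [hB, hB, group_densOp_comm h hε.le hU]
  -- `f(T)` commutes with the group because its measure is real, hence `x k j` is `Tᵏ f(T) S u` for
  -- the `j`-th smoothing operator `S`.
  let x : ℕ → ℕ → V := fun k j => B (smoothing U (c j) k u)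
  have hgen : ∀ k j, IsGen U (x k j) (x (k + 1) j) := fun k j =>
    (isGen_smoothing hU (hc j) k u).map B hcomm
  have hx0 : Tendsto (x 0) atTop (𝓝 (B u)) := (B.continuous.tendsto u).comp (hclim u)
  have hsum : Tendsto (fun j => ∑ k ∈ Finset.range (Q.natDegree + 1), Q.coeff k • x k j) atTop
      (𝓝 (B' u)) := by
    refine ((B'.continuous.tendsto u).comp (hclim u)).congr fun j => ?_
    simp only [Function.comp_apply, x, hB, hB']
    exact (densOp_smoothing_eq h h' hω hε hε' hU (hc j) Q hf
      (fun s hs => (hF s hs)) u).2.2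
  have hconv := exists_tendsto_of_polynomial R (ω + 1) x (fun k j => hR _ _ (hgen k j))
    ⟨_, hx0⟩ Q ⟨_, hsum⟩
  choose! w hw using hconv
  have hw0 : w 0 = B u := tendsto_nhds_unique (hw 0 (Nat.zero_le _)) hx0
  -- Closedness of `T` turns the limits `w k` into a chain with `w (k + 1) = T (w k)`, starting from
  -- `w 0 = f(T) u`.
  have hwgen : ∀ k < Q.natDegree, IsGen U (w k) (w (k + 1)) := fun k hk =>
    isGen_of_tendsto hU (hgen k) (hw k hk.le) (hw (k + 1) hk)
  have hwsum : ∑ k ∈ Finset.range (Q.natDegree + 1), Q.coeff k • w k = B' u := by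
    refine tendsto_nhds_unique (tendsto_finsetSum _ fun k hk => ?_) hsum
    exact (hw k (by simp only [Finset.mem_range] at hk; omega)).const_smul _
  have hfin := polyOp_generator_apply_eq Q hwgen
  rwa [hw0, hwsum] at hfin

end

/-- Uniformly bounded additive maps converging to the identity on a dense range converge to the
identity everywhere. -/
theorem tendsto_of_tendsto_approx {V : Type*} [NormedAddCommGroup V] {B : ℕ → V → V} {M : ℝ}
    (hB : ∀ n v, ‖B n v‖ ≤ M * ‖v‖) (hsub : ∀ n v w, B n (v - w) = B n v - B n w) {S : ℕ → V} {u : V}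
    (hS : Tendsto S atTop (𝓝 u))
    (hBS : ∀ j, Tendsto (fun n => B n (S j)) atTop (𝓝 (S j))) :
    Tendsto (fun n => B n u) atTop (𝓝 u) := by
  rw [Metric.tendsto_atTop]
  intro e he
  have h1 : Tendsto (fun j => (M + 1) * ‖u - S j‖) atTop (𝓝 0) := by
    have := (tendsto_const_nhds (x := u)).sub hS
    rw [sub_self] at this
    simpa using this.norm.const_mul (M + 1)
  obtain ⟨j, hj⟩ := (h1.eventually (gt_mem_nhds (half_pos he))).exists
  obtain ⟨N, hN⟩ := Metric.tendsto_atTop.1 (hBS j) (e / 2) (half_pos he)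
  refine ⟨N, fun n hn => ?_⟩
  have h2 := hN n hn
  rw [dist_eq_norm] at h2 ⊢
  have h3 : B n u - u = B n (u - S j) + (B n (S j) - S j) - (u - S j) := by rw [hsub]; abel
  calc ‖B n u - u‖ ≤ ‖B n (u - S j)‖ + ‖B n (S j) - S j‖ + ‖u - S j‖ := by
        rw [h3]; exact (norm_sub_le _ _).trans (add_le_add_left (norm_add_le _ _) _)
    _ ≤ M * ‖u - S j‖ + ‖B n (S j) - S j‖ + ‖u - S j‖ := by gcongr; exact hB n _
    _ < e := by linarith

end QuatCalc

theorem theorem5p4 {V : Type*} [NormedAddCommGroup V] [NormedSpace ℝ V] [CompleteSpace V]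
    [Module ℍ V] [Module ℍᵐᵒᵖ V] [SMulCommClass ℍᵐᵒᵖ ℍ V]
    [NormSMulClass ℍ V] [NormSMulClass ℍᵐᵒᵖ V]
    [IsScalarTower ℝ ℍ V] [SMulCommClass ℝ ℍᵐᵒᵖ V]
    (U : QuatCalc.StronglyContGroup V) (ω K : ℝ) (hω : 0 ≤ ω)
    (hU : ∀ t v, ‖U t v‖ ≤ K * Real.exp (ω * |t|) * ‖v‖)
    (f : ℍ → ℍ) (hf : f ∈ QuatCalc.classV ω)
    (hfi : ∃ δ > 0, QuatCalc.IsIntrinsicOn {s : ℍ | |s.re| < ω + δ} f)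
    (P : ℕ → Polynomial ℍ) (hP : QuatCalc.IsInvertingSequence U ω f P) :
    ∃ hdom : ∀ n u, QuatCalc.funCalc U ω f u ∈
        (QuatCalc.polyOp (P n) (QuatCalc.generator U)).domain,
      ∀ u : V, Tendsto (fun n => QuatCalc.polyOp (P n) (QuatCalc.generator U)
        ⟨QuatCalc.funCalc U ω f u, hdom n u⟩) atTop (𝓝 u) := by
  obtain ⟨ε, hε, ν, ρ, h, hfs, hcalc⟩ := QuatCalc.exists_real_isExpDensity hω hU hf hfi
  have key : ∀ n u, ∃ hd : QuatCalc.funCalc U ω f u ∈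
      (QuatCalc.polyOp (P n) (QuatCalc.generator U)).domain,
      QuatCalc.polyOp (P n) (QuatCalc.generator U) ⟨QuatCalc.funCalc U ω f u, hd⟩ =
        QuatCalc.funCalc U ω (fun s => (P n).eval s * f s) u := by
    intro n u
    rw [hcalc u]
    exact QuatCalc.polyOp_funCalc_eq hω hU hε h hfs (hP.intrinsic n) (hP.mem n) u
  refine ⟨fun n u => (key n u).choose, fun u => ?_⟩
  simp_rw [fun n => (key n u).choose_spec]
  obtain ⟨M, -, hM⟩ := hP.bounded
  obtain ⟨c, hc, hclim⟩ := QuatCalc.exists_smoothing_tendsto hU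
  refine QuatCalc.tendsto_of_tendsto_approx
    (B := fun n v => QuatCalc.funCalc U ω (fun s => (P n).eval s * f s) v) hM (fun n v w => ?_)
    (hclim u) fun j => QuatCalc.tendsto_funCalc_smoothing hω hU hε h hfs hP (hc j) u
  -- Additivity of `(Pₙ f)(T)` is read off its density.
  obtain ⟨ε', hε', ν', θ', h', -, hc'⟩ := QuatCalc.exists_isExpDensity U hω hU (hP.mem n)
  obtain ⟨B, hB⟩ := QuatCalc.exists_densOp_clm h' hε'.le hU
  simp only [hc', ← hB, map_sub]
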